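/- **The system.** $\mathcal Q^u_0$ (Farmer's version of Andrews' type theory with undefined terms) is the following system. Types: $\imath$, $o$, and $(\alpha\beta)$ (functions from $\beta$ to $\alpha$) whenever $\alpha,\beta$ are types; $\alpha\beta\gamma$ means $((\alpha\beta)\gamma)$. Primitive symbols: denumerably many variables of each type; logical constants $\mathsf Q_{o\alpha\alpha}$ (each $\alpha$) and $\iota_{\alpha(o\alpha)}$ (each $\alpha\neq o$); and an arbitrary set of nonlogical constants of each type. Wffs: variables, primitive constants, applications $[A_{\alpha\beta}B_\beta]$ of type $\alpha$, abstractions $[\lambda x_\beta A_\alpha]$ of type $\alpha\beta$. Abbreviations: $[A=B]$ is $\mathsf Q AB$; $T$ is $[\mathsf Q_{ooo}=\mathsf Q_{ooo}]$; $F$ is $[\lambda x_oT]=[\lambda x_ox_o]$; $\forall x_\alpha A$ is $[\lambda y_\alpha T]=[\lambda x_\alpha A]$; $\wedge$ is $\lambda x_o\lambda y_o[[\lambda g_{ooo}[gTT]]=[\lambda g_{ooo}[gxy]]]$; $\supset$ is $\lambda x_o\lambda y_o[x=[x\wedge y]]$; $\sim$ is $\mathsf Q_{ooo}F$; $\vee$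 is $\lambda x_o\lambda y_o{\sim}[{\sim}x\wedge{\sim}y]$; $\exists x_\alpha A$ is ${\sim}\forall x_\alpha{\sim}A$; $\exists_1x_\alpha A$ is $\exists y_\alpha[[\lambda x_\alpha A]=\mathsf Q_{o\alpha\alpha}y_\alpha]$ ($y_\alpha$ not occurring in $A$); $A_\alpha{\downarrow}$ is $\exists x_\alpha[x_\alpha=A_\alpha]$ ($x_\alpha$ not occurring in $A_\alpha$); $A{\uparrow}$ is ${\sim}[A{\downarrow}]$; $A\simeq B$ is $[A{\downarrow}\vee B{\downarrow}]\supset[A=B]$; $\mathrm I x_\alpha A$ is $\iota_{\alpha(o\alpha)}[\lambda x_\alpha A]$ ($\alpha\ne o$). All admissible choices of the bound variables in these abbreviations are allowed. $\mathsf S^{x}_{A}B$ denotes the result of substituting $A$ for the free occurrences of $x$ in $B$. Axiom schemas: (A1) $[g_{oo}T\wedge g_{oo}F]=\forall x_o[g_{oo}x_o]$; (A2) $[x_\alpha=y_\alpha]\supset[h_{o\alpha}x_\alpha=h_{o\alpha}y_\alpha]$; (A3) $[f_{\alpha\beta}=g_{\alpha\beta}]=\forall x_\beta[f_{\alpha\beta}x_\beta\simeq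 g_{\alpha\beta}x_\beta]$; (A4) $A_\alpha{\downarrow}\supset[[\lambda x_\alpha B_\beta]A_\alpha\simeq\mathsf S^{x_\alpha}_{A_\alpha}B_\beta]$, if $A_\alpha$ is free for $x_\alpha$ in $B_\beta$; (A5) $x_\alpha{\downarrow}$ for variables $x_\alpha$; (A6) $c_\alpha{\downarrow}$ for primitive constants $c_\alpha$; (A7) $[\lambda x_\alpha B_\beta]{\downarrow}$; (A8) $[A_{o\beta}B_\beta]{\downarrow}$; (A9) $[A_{o\beta}{\uparrow}\vee B_\beta{\uparrow}]\supset{\sim}[A_{o\beta}B_\beta]$; (A10) $[A_{\alpha\beta}{\uparrow}\vee B_\beta{\uparrow}]\supset[A_{\alpha\beta}B_\beta]{\uparrow}$, $\alpha\neq o$; (A11) $A_\alpha{\downarrow}\supset[B_\alpha{\downarrow}\supset[[A_\alpha\simeq B_\alpha]\simeq[A_\alpha=B_\alpha]]]$; (A12) $\exists_1x_\alpha A_o\supset[[\mathrm Ix_\alpha A_o]{\downarrow}\wedge\mathsf S^{x_\alpha}_{\mathrm Ix_\alpha A_o}A_o]$, $\alpha\ne o$, if $\mathrm Ix_\alpha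 A_o$ is free for $x_\alpha$ in $A_o$; (A13) ${\sim}[\exists_1x_\alpha A_o]\supset[\mathrm Ix_\alpha A_o]{\uparrow}$, $\alpha\ne o$. Rules: (R1) from $A_\alpha\simeq B_\alpha$ and $C_o$ infer the result of replacing one occurrence of $A_\alpha$ in $C_o$ (not an occurrence of a variable immediately preceded by $\lambda$) by $B_\alpha$; (R2) from $A_o$ and $A_o\supset B_o$ infer $B_o$. Theorems are the wffs derivable from the axioms by R1 and R2. For a set $\mathcal H$ of wffs of type $o$, $\mathcal H\vdash A_o$ means that $A_o$ is derivable from the members of $\mathcal H$ and the theorems by R2 and by R1, where R1 is restricted: the replaced occurrence of $A_\alpha$ may not lie in a part $[\lambda x_\beta E]$ of $C_o$ with $x_\beta$ free in a member of $\mathcal H$ and free in $A_\alpha\simeq B_\alpha$. A *cwff* is a closed wff and a *sentence* is a cwff of type $o$. $\mathcal H$ is *consistent* if not $\mathcal H\vdash F$. A set $\mathcal H$ of sentences is *complete* if for every sentence $A_o$ either $\mathcal H\vdash A_o$ or $\mathcal H\vdash{\sim}A_o$. It is *extensionally complete* if for every sentence of the form $A_{\alpha\beta}=B_{\alpha\beta}$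 there is a cwff $C_\beta$ such that 1. $\mathcal H\vdash C_\beta{\downarrow}$, and 2. $\mathcal H\vdash[A_{\alpha\beta}{\downarrow}\wedge B_{\alpha\beta}{\downarrow}\wedge[A_{\alpha\beta}C_\beta\simeq B_{\alpha\beta}C_\beta]]\supset[A_{\alpha\beta}=B_{\alpha\beta}]$. An *expansion* of $\mathcal Q^u_0$ is the system obtained by adding new nonlogical constants, and $\mathcal L(\cdot)$ denotes the set of all wffs of a system. **Extension Lemma.** Let $\mathcal G$ be a consistent set of sentences of $\mathcal Q^u_0$. Then there are an expansion $\overline{\mathcal Q^u_0}$ of $\mathcal Q^u_0$ and a set $\mathcal H$ of sentences of $\overline{\mathcal Q^u_0}$ such that: 1. $\mathcal G\subseteq\mathcal H$; 2. $\mathcal H$ is consistent (in $\overline{\mathcal Q^u_0}$); 3. $\mathcal H$ is complete in $\overline{\mathcal Q^u_0}$; 4. $\mathcal H$ is extensionally complete in $\overline{\mathcal Q^u_0}$; 5. $\operatorname{card}\mathcal L(\overline{\mathcal Q^u_0})=\operatorname{card}\mathcal L(\mathcal Q^u_0)$. -/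

import Mathlib

universe u

namespace Q0u

/-- Type symbols. `fn α β` is the type symbol `(αβ)`: functions from type `β` to type `α`. -/
inductive Ty : Type
  | ind : Ty
  | o : Ty
  | fn : Ty → Ty → Ty
  deriving DecidableEq

open Ty

/-- Primitive constants: the logical constants `Q_{oαα}` and `ι_{α(oα)}` (the latter for `α ≠ o`
only), and the nonlogical constants, `C α` being the set of those of type `α`.  The family `C`
determines the system. -/
inductive PrimConst (C : Ty → Type u) : Ty → Type u
  | Q (α : Ty) : PrimConst C (fn (fn o α) α)
  | iota (α : Ty) (h : α ≠ o) : PrimConst C (fn α (fn o α))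
  | nonlog {α : Ty} (c : C α) : PrimConst C α

/-- `Wff C α` is the set of wffs of type `α`.  The variables of type `α` are numbered by the
natural numbers: `var α n` is the `n`-th variable of type `α`, in the enumeration
`f, g, h, x, y, z, f¹, g¹, h¹, x¹, y¹, z¹, …`.  `lam β n A` is `[λ x_β A]` where `x_β` is
the `n`-th variable of type `β`. -/
inductive Wff (C : Ty → Type u) : Ty → Type u
  | var (α : Ty) (n : ℕ) : Wff C α
  | const {α : Ty} (c : PrimConst C α) : Wff C α
  | app {α β : Ty} (F : Wff C (fn α β)) (A : Wff C β) : Wff C α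
  | lam (β : Ty) (n : ℕ) {α : Ty} (A : Wff C α) : Wff C (fn α β)

namespace Wff

variable {C : Ty → Type u}

/-! ### Occurrences, free variables, substitution -/

/-- The variable number `n` of type `β` occurs (free, bound, or next to a `λ`) in a wff. -/
def Occurs (β : Ty) (n : ℕ) : {α : Ty} → Wff C α → Prop
  | _, var γ m => γ = β ∧ m = n
  | _, const _ => False
  | _, app F A => F.Occurs β n ∨ A.Occurs β n
  | _, lam γ m A => (γ = β ∧ m = n) ∨ A.Occurs β n

/-- The variable number `n` of type `β` is free in a wff. -/
def Free (β : Ty) (n : ℕ) : {α : Ty} → Wff C α → Prop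
  | _, var γ m => γ = β ∧ m = n
  | _, const _ => False
  | _, app F A => F.Free β n ∨ A.Free β n
  | _, lam γ m A => ¬ (γ = β ∧ m = n) ∧ A.Free β n

/-- Closed wffs (cwffs). A sentence is a closed wff of type `o`. -/
def Closed {α : Ty} (A : Wff C α) : Prop := ∀ (β : Ty) (n : ℕ), ¬ A.Free β n

/-- `subst β n A B` is the result of substituting `A` for each free occurrence in `B` of the
variable number `n` of type `β`. -/
def subst (β : Ty) (n : ℕ) (A : Wff C β) : {α : Ty} → Wff C α → Wff C α
  | _, var γ m => if h : β = γ ∧ m = n then h.1 ▸ A else var γ m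
  | _, const c => const c
  | _, app F B => app (subst β n A F) (subst β n A B)
  | _, lam γ m B => if γ = β ∧ m = n then lam γ m B else lam γ m (subst β n A B)

/-- `FreeFor β n A B`: the wff `A` is free for the variable number `n` of type `β` in `B`, i.e. no
free occurrence of this variable in `B` lies in a part `[λ y D]` of `B` with `y` free in `A`. -/
def FreeFor (β : Ty) (n : ℕ) (A : Wff C β) : {α : Ty} → Wff C α → Prop
  | _, var _ _ => True
  | _, const _ => True
  | _, app F B => FreeFor β n A F ∧ FreeFor β n A B
  | _, lam γ m B => (lam γ m B).Free β n → ¬ A.Free γ m ∧ FreeFor β n A B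

/-- The numbers of those variables of type `β` that do not occur in the wff `A`. -/
def Fresh {α : Ty} (β : Ty) (A : Wff C α) : Type := {n : ℕ // ¬ A.Occurs β n}

theorem exists_bound (β : Ty) : {α : Ty} → (A : Wff C α) → ∃ N, ∀ n, A.Occurs β n → n < N
  | _, var _ m => ⟨m + 1, fun _ h => Nat.lt_succ_of_le h.2.ge⟩
  | _, const _ => ⟨0, fun _ h => h.elim⟩
  | _, app F A => by
      obtain ⟨N, hN⟩ := exists_bound β F
      obtain ⟨M, hM⟩ := exists_bound β A
      refine ⟨max N M, fun n h => ?_⟩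
      rcases h with h | h
      · exact lt_max_of_lt_left (hN n h)
      · exact lt_max_of_lt_right (hM n h)
  | _, lam _ m A => by
      obtain ⟨N, hN⟩ := exists_bound β A
      refine ⟨max (m + 1) N, fun n h => ?_⟩
      rcases h with h | h
      · exact lt_max_of_lt_left (Nat.lt_succ_of_le h.2.ge)
      · exact lt_max_of_lt_right (hN n h)

/-- There always is a fresh variable. -/
instance {α : Ty} (β : Ty) (A : Wff C α) : Nonempty (Fresh β A) := by
  obtain ⟨N, hN⟩ := exists_bound β A
  exact ⟨⟨N, fun h => lt_irrefl N (hN N h)⟩⟩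

/-! ### Defined constants and abbreviations -/

/-- The variable `f` of type `α`. -/
def vf (α : Ty) : Wff C α := var α 0

/-- The variable `g` of type `α`. -/
def vg (α : Ty) : Wff C α := var α 1

/-- The variable `h` of type `α`. -/
def vh (α : Ty) : Wff C α := var α 2

/-- The variable `x` of type `α`. -/
def vx (α : Ty) : Wff C α := var α 3

/-- The variable `y` of type `α`. -/
def vy (α : Ty) : Wff C α := var α 4

/-- `[λ g A]`, where `g` has type `β`. -/
def lamg (β : Ty) {α : Ty} (A : Wff C α) : Wff C (fn α β) := lam β 1 A

/-- `[λ x A]`, where `x` has type `β`. -/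
def lamx (β : Ty) {α : Ty} (A : Wff C α) : Wff C (fn α β) := lam β 3 A

/-- `[λ y A]`, where `y` has type `β`. -/
def lamy (β : Ty) {α : Ty} (A : Wff C α) : Wff C (fn α β) := lam β 4 A

/-- The wff `Q_{oαα}`. -/
def Q (α : Ty) : Wff C (fn (fn o α) α) := const (PrimConst.Q α)

/-- `[A = B]` -/
def eq {α : Ty} (A B : Wff C α) : Wff C o := app (app (Q α) A) B

/-- `T_o` is `[Q_{ooo} = Q_{ooo}]`. -/
def tru : Wff C o := eq (Q o) (Q o)

/-- `F_o` is `[λ x_o T_o] = [λ x_o x_o]`. -/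
def fls : Wff C o := eq (lamx o tru) (lamx o (vx o))

/-- `[∀ x_α A]` is `[λ y_α T_o] = [λ x_α A]`; here `x_α` is the variable number `n` of type `α`. -/
def all (α : Ty) (n : ℕ) (A : Wff C o) : Wff C o := eq (lamy α tru) (lam α n A)

/-- `∧_{ooo}` is `[λ x_o λ y_o [[λ g_{ooo} [g_{ooo} T_o T_o]] = [λ g_{ooo} [g_{ooo} x_o y_o]]]]`. -/
def andC : Wff C (fn (fn o o) o) :=
  lamx o (lamy o (eq
    (lamg (fn (fn o o) o) (app (app (vg (fn (fn o o) o)) tru) tru))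
    (lamg (fn (fn o o) o) (app (app (vg (fn (fn o o) o)) (vx o)) (vy o)))))

/-- `[A ∧ B]` -/
def and (A B : Wff C o) : Wff C o := app (app andC A) B

/-- `⊃_{ooo}` is `[λ x_o λ y_o [x_o = [x_o ∧ y_o]]]`. -/
def impC : Wff C (fn (fn o o) o) := lamx o (lamy o (eq (vx o) (and (vx o) (vy o))))

/-- `[A ⊃ B]` -/
def imp (A B : Wff C o) : Wff C o := app (app impC A) B

/-- `∼_{oo}` is `[Q_{ooo} F_o]`. -/
def notC : Wff C (fn o o) := app (Q o) fls

/-- `[∼ A]` -/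
def not (A : Wff C o) : Wff C o := app notC A

/-- `∨_{ooo}` is `[λ x_o λ y_o [∼ [[∼ x_o] ∧ [∼ y_o]]]]`. -/
def orC : Wff C (fn (fn o o) o) := lamx o (lamy o (not (and (not (vx o)) (not (vy o)))))

/-- `[A ∨ B]` -/
def or (A B : Wff C o) : Wff C o := app (app orC A) B

/-- `[∃ x_α A]` is `[∼ [∀ x_α [∼ A]]]`; here `x_α` is the variable number `n` of type `α`. -/
def ex (α : Ty) (n : ℕ) (A : Wff C o) : Wff C o := not (all α n (not A))

/-- `[∃₁ x_α A]` is `[∃ y_α [[λ x_α A] = [Q_{oαα} y_α]]]`, where `y_α` does not occur in `A`. Here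
`x_α` is the variable number `n` and `y_α` the variable number `k` of type `α`. -/
def exUnique (α : Ty) (n : ℕ) (A : Wff C o) (k : Fresh α A) : Wff C o :=
  ex α k.1 (eq (lam α n A) (app (Q α) (var α k.1)))

/-- `[A↓]` is `[∃ x_α [x_α = A]]`, where `x_α` does not occur in `A`; here `x_α` is the variable
number `k` of type `α`. -/
def defd {α : Ty} (A : Wff C α) (k : Fresh α A) : Wff C o := ex α k.1 (eq (var α k.1) A)

/-- `[A↑]` is `[∼ [A↓]]`. -/
def undefd {α : Ty} (A : Wff C α) (k : Fresh α A) : Wff C o := not (defd A k)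

/-- `[A ≃ B]` is `[A↓ ∨ B↓] ⊃ [A = B]`; `k` and `l` are the numbers of the bound variables that
are used in `A↓` and `B↓`. -/
def qeq {α : Ty} (A B : Wff C α) (k : Fresh α A) (l : Fresh α B) : Wff C o :=
  imp (or (defd A k) (defd B l)) (eq A B)

/-- `[I x_α A]` is `[ι_{α(oα)} [λ x_α A]]`, for `α ≠ o`; `x_α` is the variable number `n` of type
`α`. -/
def desc (α : Ty) (hα : α ≠ o) (n : ℕ) (A : Wff C o) : Wff C α :=
  app (const (PrimConst.iota α hα)) (lam α n A)

/-! ### The proof system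

Where an abbreviation leaves the choice of a bound variable open, every admissible choice is
allowed, in the instances of the schemas and in the rule R1. -/

/-- The instances of the schemas A1, …, A13. -/
inductive Schema : Wff C o → Prop
  /-- Truth values. -/
  | A1 : Schema (eq
      (and (app (vg (fn o o)) tru) (app (vg (fn o o)) fls))
      (all o 3 (app (vg (fn o o)) (vx o))))
  /-- Leibniz' law. -/
  | A2 (α : Ty) : Schema (imp
      (eq (vx α) (vy α))
      (eq (app (vh (fn o α)) (vx α)) (app (vh (fn o α)) (vy α))))
  /-- Extensionality. -/
  | A3 (α β : Ty) (k l) : Schema (eq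
      (eq (vf (fn α β)) (vg (fn α β)))
      (all β 3 (qeq (app (vf (fn α β)) (vx β)) (app (vg (fn α β)) (vx β)) k l)))
  /-- Beta-reduction. -/
  | A4 {α β : Ty} (n : ℕ) (A : Wff C α) (B : Wff C β) (h : FreeFor α n A B) (j k l) :
      Schema (imp (defd A j) (qeq (app (lam α n B) A) (subst α n A B) k l))
  /-- Variables are defined. -/
  | A5 (α : Ty) (n : ℕ) (k) : Schema (defd (var α n) k)
  /-- Primitive constants are defined. -/
  | A6 {α : Ty} (c : PrimConst C α) (k) : Schema (defd (const c) k)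
  /-- Function abstractions are defined. -/
  | A7 (α : Ty) (n : ℕ) {β : Ty} (B : Wff C β) (k) : Schema (defd (lam α n B) k)
  /-- Function applications of type `o` are defined. -/
  | A8 {β : Ty} (A : Wff C (fn o β)) (B : Wff C β) (k) : Schema (defd (app A B) k)
  /-- Improper function application of type `o`. -/
  | A9 {β : Ty} (A : Wff C (fn o β)) (B : Wff C β) (k l) :
      Schema (imp (or (undefd A k) (undefd B l)) (not (app A B)))
  /-- Improper function application of type `α ≠ o`. -/
  | A10 {α β : Ty} (hα : α ≠ o) (A : Wff C (fn α β)) (B : Wff C β) (j k l) :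
      Schema (imp (or (undefd A j) (undefd B k)) (undefd (app A B) l))
  /-- Equality and quasi-equality. -/
  | A11 {α : Ty} (A B : Wff C α) (i j k l p q) :
      Schema (imp (defd A i) (imp (defd B j) (qeq (qeq A B k l) (eq A B) p q)))
  /-- Proper definite description. -/
  | A12 {α : Ty} (hα : α ≠ o) (n : ℕ) (A : Wff C o)
      (h : FreeFor α n (desc α hα n A) A) (k l) :
      Schema (imp (exUnique α n A k)
        (and (defd (desc α hα n A) l) (subst α n (desc α hα n A) A)))
  /-- Improper definite description. -/
  | A13 {α : Ty} (hα : α ≠ o) (n : ℕ) (A : Wff C o) (k l) :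
      Schema (imp (not (exUnique α n A k)) (undefd (desc α hα n A) l))

/-- `Replace P A B D E`: the wff `E` is the result of replacing one occurrence of `A` in `D` by an
occurrence of `B`, where the occurrence of `A` is not in a well-formed part `[λ x_β D']` of `D`
such that the variable `x_β`, number `n` of type `β`, satisfies `P β n`.  (The variable next to a
`λ` is not a subterm of `lam`, so it is never replaced.) -/
inductive Replace (P : Ty → ℕ → Prop) {α : Ty} (A B : Wff C α) :
    {γ : Ty} → Wff C γ → Wff C γ → Prop
  | here : Replace P A B A B
  | appLeft {γ δ : Ty} {F F' : Wff C (fn γ δ)} (D : Wff C δ) :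
      Replace P A B F F' → Replace P A B (app F D) (app F' D)
  | appRight {γ δ : Ty} (F : Wff C (fn γ δ)) {D D' : Wff C δ} :
      Replace P A B D D' → Replace P A B (app F D) (app F D')
  | lam (β : Ty) (n : ℕ) {γ : Ty} {D D' : Wff C γ} :
      ¬ P β n → Replace P A B D D' → Replace P A B (lam β n D) (lam β n D')

/-- `Thm A`: the wff `A` of type `o` is a theorem. -/
inductive Thm : Wff C o → Prop
  | schema {A : Wff C o} : Schema A → Thm A
  | R1 {α : Ty} {A B : Wff C α} {k l} {D E : Wff C o} :
      Thm (qeq A B k l) → Thm D → Replace (fun _ _ => False) A B D E → Thm E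
  | R2 {A B : Wff C o} : Thm A → Thm (imp A B) → Thm B

/-- `Proves H A`: there is a proof of `A` from the set `H` of wffs of type `o`. In an application
of R1 the replaced occurrence of `A` must not be in a part `[λ x D']` where `x` is free in a member
of `H` and free in `A ≃ B`. -/
inductive Proves (H : Set (Wff C o)) : Wff C o → Prop
  | hyp {A : Wff C o} : A ∈ H → Proves H A
  | thm {A : Wff C o} : Thm A → Proves H A
  | R1 {α : Ty} {A B : Wff C α} {k l} {D E : Wff C o} :
      Proves H (qeq A B k l) → Proves H D →
      Replace (fun β n => (∃ G ∈ H, G.Free β n) ∧ (qeq A B k l).Free β n) A B D E →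
      Proves H E
  | R2 {A B : Wff C o} : Proves H A → Proves H (imp A B) → Proves H B

/-! ### Consistency and completeness -/

/-- There is no proof of `F_o` from `H`. -/
def Consistent (H : Set (Wff C o)) : Prop := ¬ Proves H fls

/-- `H` is a set of sentences. -/
def AreSentences (H : Set (Wff C o)) : Prop := ∀ A ∈ H, A.Closed

/-- From `H` one can prove or refute every sentence. -/
def Complete (H : Set (Wff C o)) : Prop :=
  ∀ A : Wff C o, A.Closed → Proves H A ∨ Proves H (not A)

/-- For every sentence `A_{αβ} = B_{αβ}` there is a cwff `D_β` such that `H` proves `D↓` and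
`[A↓ ∧ B↓ ∧ [A D ≃ B D]] ⊃ [A = B]` (for all admissible choices of the bound variables in these
abbreviations). -/
def ExtensionallyComplete (H : Set (Wff C o)) : Prop :=
  ∀ (α β : Ty) (A B : Wff C (fn α β)), (eq A B).Closed →
    ∃ D : Wff C β, D.Closed ∧
      (∀ k, Proves H (defd D k)) ∧
      ∀ i j k l, Proves H
        (imp (and (and (defd A i) (defd B j)) (qeq (app A D) (app B D) k l)) (eq A B))

end Wff

/-- `Lang C` is the set of all wffs of the system with nonlogical constants `C`. -/
def Lang (C : Ty → Type u) : Type u := Σ α : Ty, Wff C α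

/-- The nonlogical constants of the expansion obtained by adding the elements of `N α` as new
nonlogical constants of type `α`, for each `α`. -/
def Expand (C N : Ty → Type u) : Ty → Type u := fun α => C α ⊕ N α

/-- A primitive constant, as a primitive constant of the expansion. -/
def PrimConst.expand {C : Ty → Type u} (N : Ty → Type u) :
    {α : Ty} → PrimConst C α → PrimConst (Expand C N) α
  | _, Q α => Q α
  | _, iota α h => iota α h
  | _, nonlog c => nonlog (Sum.inl c)

/-- A wff, as a wff of the expansion. -/
def Wff.expand {C : Ty → Type u} (N : Ty → Type u) :
    {α : Ty} → Wff C α → Wff (Expand C N) α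
  | _, var α n => var α n
  | _, const c => const (c.expand N)
  | _, app F A => app (F.expand N) (A.expand N)
  | _, lam β n A => lam β n (A.expand N)

end Q0u

/-! The language is enlarged once: for every pair `p` of closed wffs `A`, `B` of equal functional
type in the enlarged language there is a new constant `c`, with the axiom `p.ax` saying that if `A`
and `B` are defined and agree at `c` (in the sense of `≃`) then `A = B`. The hypotheses together
with all these axioms are consistent, Zorn's lemma extends them to a complete consistent set, and
that set is extensionally complete because it contains the axioms.

Constants for pairs of the enlarged language are available without iterating the construction
because the old and the enlarged language are equinumerous (`mk_lang_expand`): old wffs serve as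
codes of new equations. A constant also carries a number, its level, which exceeds the levels of the
constants in the pair it serves. This makes the dependence of witnesses on each other well-founded.

Consistency (`consistent_witnesses`) concerns finitely many axioms at a time. One of maximal level
has a witness `c` occurring in no other axiom. If adding it gave a contradiction, the deduction
theorem would make the rest prove `A↓`, `B↓`, `A c ≃ B c` and `∼[A = B]`. Replacing `c` by a new
variable in that proof (`Proves.tr`), generalizing and applying extensionality gives `A = B`, a
contradiction.

Most of the work lies in developing the calculus up to the deduction theorem. Since hypotheses are
sentences, the restriction on R1 is vacuous, so provable quasi-equality `Rw` is a congruence by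
which any subterm may be rewritten. Extensionality and A1 then give truth tables, hence all
tautologies (`PForm.taut`). Strictness of application (A9, A10) makes quasi-equality a congruence
under an implication as well (`Replace.proves_imp_qe`), which is the R1 case of the deduction
theorem. -/

namespace Q0u

open Ty

namespace Wff

variable {C : Ty → Type u}

/-! ### Free variables, substitution and bounds -/

/-- A bound for the numbers of all the variables occurring in a wff. -/
def bd : {α : Ty} → Wff C α → ℕ
  | _, var _ m => m + 1
  | _, const _ => 0
  | _, app F A => max F.bd A.bd
  | _, lam _ m A => max (m + 1) A.bd

theorem Occurs.lt_bd {β : Ty} {n : ℕ} : {α : Ty} → {A : Wff C α} → A.Occurs β n → n < A.bd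
  | _, var _ _, h => by simp only [Occurs] at h; simp only [bd]; omega
  | _, const _, h => h.elim
  | _, app _ _, h => h.elim (fun h => lt_max_of_lt_left h.lt_bd) fun h => lt_max_of_lt_right h.lt_bd
  | _, lam _ _ _, h => h.elim (fun h => lt_max_of_lt_left (by omega))
      fun h => lt_max_of_lt_right h.lt_bd

theorem Free.occurs {β : Ty} {n : ℕ} : {α : Ty} → {A : Wff C α} → A.Free β n → A.Occurs β n
  | _, var _ _, h => h
  | _, const _, h => h
  | _, app _ _, h => h.imp Free.occurs Free.occurs
  | _, lam _ _ _, h => Or.inr h.2.occurs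

theorem not_occurs_of_bd_le {α β : Ty} {A : Wff C α} {n : ℕ} (h : A.bd ≤ n) : ¬ A.Occurs β n :=
  fun h' => absurd h'.lt_bd (not_lt.2 h)

theorem not_free_of_bd_le {α β : Ty} {A : Wff C α} {n : ℕ} (h : A.bd ≤ n) : ¬ A.Free β n :=
  fun h' => not_occurs_of_bd_le h h'.occurs

/-- A variable number beyond the bound, as a fresh variable. -/
def freshOf {α : Ty} (β : Ty) (A : Wff C α) (n : ℕ) (h : A.bd ≤ n) : Fresh β A :=
  ⟨n, not_occurs_of_bd_le h⟩

theorem subst_of_not_free {β : Ty} {n : ℕ} {A : Wff C β} :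
    {α : Ty} → {B : Wff C α} → ¬ B.Free β n → subst β n A B = B
  | _, var γ m, h => by
      simp only [Free] at h
      have : ¬ (β = γ ∧ m = n) := fun h' => h ⟨h'.1.symm, h'.2⟩
      simp [subst, this]
  | _, const _, _ => rfl
  | _, app F B, h => by
      simp only [Free, not_or] at h
      simp [subst, subst_of_not_free h.1, subst_of_not_free h.2]
  | _, lam γ m B, h => by
      simp only [Free, not_and] at h
      by_cases h' : γ = β ∧ m = n
      · simp [subst, h']
      · simp [subst, h', subst_of_not_free (h (not_and.1 h'))]

theorem subst_self {β : Ty} {n : ℕ} : {α : Ty} → (B : Wff C α) → subst β n (var β n) B = B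
  | _, var γ m => by
      by_cases h : β = γ ∧ m = n
      · obtain ⟨rfl, rfl⟩ := h; simp [subst]
      · simp [subst, h]
  | _, const _ => rfl
  | _, app F B => by simp [subst, subst_self F, subst_self B]
  | _, lam γ m B => by simp [subst, subst_self B]

theorem freeFor_of_not_free {β : Ty} {n : ℕ} {A : Wff C β} :
    {α : Ty} → {B : Wff C α} → ¬ B.Free β n → FreeFor β n A B
  | _, var _ _, _ => trivial
  | _, const _, _ => trivial
  | _, app _ _, h => by
      simp only [Free, not_or] at h
      exact ⟨freeFor_of_not_free h.1, freeFor_of_not_free h.2⟩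
  | _, lam _ _ _, h => fun h' => (h h').elim

theorem freeFor_self {β : Ty} {n : ℕ} : {α : Ty} → (B : Wff C α) → FreeFor β n (var β n) B
  | _, var _ _ => trivial
  | _, const _ => trivial
  | _, app F B => ⟨freeFor_self F, freeFor_self B⟩
  | _, lam _ _ B => fun h => ⟨fun h' => h.1 ⟨h'.1.symm, h'.2.symm⟩, freeFor_self B⟩

theorem freeFor_of_bound {β : Ty} {n : ℕ} {A : Wff C β} :
    {α : Ty} → {B : Wff C α} → (∀ γ m, B.Occurs γ m → ¬ A.Free γ m) → FreeFor β n A B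
  | _, var _ _, _ => trivial
  | _, const _, _ => trivial
  | _, app _ _, h => ⟨freeFor_of_bound fun γ m h' => h γ m (Or.inl h'),
      freeFor_of_bound fun γ m h' => h γ m (Or.inr h')⟩
  | _, lam _ _ _, h => fun _ => ⟨h _ _ (Or.inl ⟨rfl, rfl⟩),
      freeFor_of_bound fun γ m h' => h γ m (Or.inr h')⟩

/-! ### Definedness and quasi-equality with numbered bound variables -/

/-- `∃ x [x = A]`, where `x` is the variable number `k`. -/
def dn {α : Ty} (k : ℕ) (A : Wff C α) : Wff C o := ex α k (eq (var α k) A)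

/-- The wff `A ≃ B`, with the bound variables numbered `k` and `l`. -/
def qn {α : Ty} (k l : ℕ) (A B : Wff C α) : Wff C o := imp (or (dn k A) (dn l B)) (eq A B)

section simp_lemmas

variable {α β : Ty} {n : ℕ}

@[simp] theorem free_var {γ m} : (var γ m : Wff C γ).Free β n ↔ γ = β ∧ m = n := Iff.rfl
@[simp] theorem free_const (c : PrimConst C α) : (const c).Free β n ↔ False := Iff.rfl
@[simp] theorem free_app {γ} (F : Wff C (fn α γ)) (A : Wff C γ) :
    (app F A).Free β n ↔ F.Free β n ∨ A.Free β n := Iff.rfl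
@[simp] theorem free_lam {γ m} (A : Wff C α) :
    (lam γ m A).Free β n ↔ ¬ (γ = β ∧ m = n) ∧ A.Free β n := Iff.rfl
@[simp] theorem free_eq (A B : Wff C α) : (eq A B).Free β n ↔ A.Free β n ∨ B.Free β n := by
  simp [eq, Q]
@[simp] theorem free_tru : (tru : Wff C o).Free β n ↔ False := by simp [tru, Q]
@[simp] theorem free_fls : (fls : Wff C o).Free β n ↔ False := by simp [fls, lamx, vx]
@[simp] theorem free_andC : (andC : Wff C _).Free β n ↔ False := by
  simp [andC, lamx, lamy, lamg, vx, vy, vg]; tauto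
@[simp] theorem free_and (A B : Wff C o) : (and A B).Free β n ↔ A.Free β n ∨ B.Free β n := by
  simp [and]
@[simp] theorem free_impC : (impC : Wff C _).Free β n ↔ False := by
  simp [impC, lamx, lamy, vx, vy]; tauto
@[simp] theorem free_imp (A B : Wff C o) : (imp A B).Free β n ↔ A.Free β n ∨ B.Free β n := by
  simp [imp]
@[simp] theorem free_notC : (notC : Wff C _).Free β n ↔ False := by simp [notC, Q]
@[simp] theorem free_not (A : Wff C o) : (not A).Free β n ↔ A.Free β n := by simp [not]
@[simp] theorem free_orC : (orC : Wff C _).Free β n ↔ False := by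
  simp [orC, lamx, lamy, vx, vy]; tauto
@[simp] theorem free_or (A B : Wff C o) : (or A B).Free β n ↔ A.Free β n ∨ B.Free β n := by
  simp [or]
@[simp] theorem free_all {k} (A : Wff C o) :
    (all α k A).Free β n ↔ ¬ (α = β ∧ k = n) ∧ A.Free β n := by simp [all, lamy]
@[simp] theorem free_ex {k} (A : Wff C o) :
    (ex α k A).Free β n ↔ ¬ (α = β ∧ k = n) ∧ A.Free β n := by simp [ex]
@[simp] theorem free_dn {k} (A : Wff C α) :
    (dn k A).Free β n ↔ ¬ (α = β ∧ k = n) ∧ A.Free β n := by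
  simp only [dn, free_ex, free_eq, free_var]; tauto
@[simp] theorem free_qn {k l} (A B : Wff C α) :
    (qn k l A B).Free β n ↔ A.Free β n ∨ B.Free β n := by
  simp only [qn, free_imp, free_or, free_eq, free_dn]; tauto

variable {D : Wff C β}

@[simp] theorem subst_var : subst β n D (var β n) = D := by simp [subst]
theorem subst_var_ne {γ m} (h : ¬ (β = γ ∧ m = n)) : subst β n D (var γ m) = var γ m := by
  simp [subst, h]
@[simp] theorem subst_const (c : PrimConst C α) : subst β n D (const c) = const c := rfl
@[simp] theorem subst_app {γ} (F : Wff C (fn α γ)) (A : Wff C γ) :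
    subst β n D (app F A) = app (subst β n D F) (subst β n D A) := rfl
theorem subst_lam {γ m} (A : Wff C α) (h : ¬ (γ = β ∧ m = n)) :
    subst β n D (lam γ m A) = lam γ m (subst β n D A) := by simp [subst, h]
@[simp] theorem subst_eq (A B : Wff C α) :
    subst β n D (eq A B) = eq (subst β n D A) (subst β n D B) := rfl
@[simp] theorem subst_tru : subst β n D tru = tru := subst_of_not_free (by simp)
@[simp] theorem subst_fls : subst β n D fls = fls := subst_of_not_free (by simp)
@[simp] theorem subst_and (A B : Wff C o) :
    subst β n D (and A B) = and (subst β n D A) (subst β n D B) := by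
  simp [and, subst_of_not_free (B := andC)]
@[simp] theorem subst_imp (A B : Wff C o) :
    subst β n D (imp A B) = imp (subst β n D A) (subst β n D B) := by
  simp [imp, subst_of_not_free (B := impC)]
@[simp] theorem subst_or (A B : Wff C o) :
    subst β n D (or A B) = or (subst β n D A) (subst β n D B) := by
  simp [or, subst_of_not_free (B := orC)]
@[simp] theorem subst_not (A : Wff C o) :
    subst β n D (not A) = not (subst β n D A) := by
  simp [not, subst_of_not_free (B := notC)]
theorem subst_all {k} (A : Wff C o) (h : ¬ (α = β ∧ k = n)) :
    subst β n D (all α k A) = all α k (subst β n D A) := by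
  have : subst β n D (lamy α tru) = lamy α tru := subst_of_not_free (by simp [lamy])
  simp [all, subst_lam A h, this]
theorem subst_dn {k} (A : Wff C α) (h : ¬ (α = β ∧ k = n)) :
    subst β n D (dn k A) = dn k (subst β n D A) := by
  have : ¬ (β = α ∧ k = n) := fun h' => h ⟨h'.1.symm, h'.2⟩
  simp [dn, ex, subst_all _ h, subst_var_ne this]
theorem subst_qn {k l} (A B : Wff C α) (hk : ¬ (α = β ∧ k = n)) (hl : ¬ (α = β ∧ l = n)) :
    subst β n D (qn k l A B) = qn k l (subst β n D A) (subst β n D B) := by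
  simp [qn, subst_dn _ hk, subst_dn _ hl]

@[simp] theorem freeFor_var {γ m} : FreeFor β n D (var γ m) := trivial
@[simp] theorem freeFor_const (c : PrimConst C α) : FreeFor β n D (const c) := trivial
@[simp] theorem freeFor_app {γ} (F : Wff C (fn α γ)) (A : Wff C γ) :
    FreeFor β n D (app F A) ↔ FreeFor β n D F ∧ FreeFor β n D A := Iff.rfl
theorem freeFor_lam {γ m} {A : Wff C α} (h : ¬ D.Free γ m) (h' : FreeFor β n D A) :
    FreeFor β n D (lam γ m A) := fun _ => ⟨h, h'⟩
@[simp] theorem freeFor_eq (A B : Wff C α) :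
    FreeFor β n D (eq A B) ↔ FreeFor β n D A ∧ FreeFor β n D B := by simp [eq, Q]
@[simp] theorem freeFor_tru : FreeFor β n D tru := freeFor_of_not_free (by simp)
@[simp] theorem freeFor_fls : FreeFor β n D fls := freeFor_of_not_free (by simp)
@[simp] theorem freeFor_and (A B : Wff C o) :
    FreeFor β n D (and A B) ↔ FreeFor β n D A ∧ FreeFor β n D B := by
  simp [and, freeFor_of_not_free (B := andC)]
@[simp] theorem freeFor_imp (A B : Wff C o) :
    FreeFor β n D (imp A B) ↔ FreeFor β n D A ∧ FreeFor β n D B := by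
  simp [imp, freeFor_of_not_free (B := impC)]
@[simp] theorem freeFor_or (A B : Wff C o) :
    FreeFor β n D (or A B) ↔ FreeFor β n D A ∧ FreeFor β n D B := by
  simp [or, freeFor_of_not_free (B := orC)]
@[simp] theorem freeFor_not (A : Wff C o) :
    FreeFor β n D (not A) ↔ FreeFor β n D A := by
  simp [not, freeFor_of_not_free (B := notC)]
theorem freeFor_all {k} {A : Wff C o} (h : ¬ D.Free α k) (h' : FreeFor β n D A) :
    FreeFor β n D (all α k A) := by
  simp only [all, freeFor_eq]
  exact ⟨freeFor_of_not_free (by simp [lamy]), freeFor_lam h h'⟩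
theorem freeFor_dn {k} {A : Wff C α} (h : ¬ D.Free α k) (h' : FreeFor β n D A) :
    FreeFor β n D (dn k A) := by
  simp only [dn, ex, freeFor_not]
  exact freeFor_all h (by simpa using h')
theorem freeFor_qn {k l} {A B : Wff C α} (hk : ¬ D.Free α k) (hl : ¬ D.Free α l)
    (hA : FreeFor β n D A) (hB : FreeFor β n D B) : FreeFor β n D (qn k l A B) := by
  simp [qn, freeFor_dn hk hA, freeFor_dn hl hB, hA, hB]

end simp_lemmas

end Wff

end Q0u

namespace Q0u

open Ty

namespace Wff

variable {C : Ty → Type u}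

/-! ### Quasi-equality as a congruence -/

/-- Unrestricted replacement of one occurrence. -/
abbrev Rep {α γ : Ty} (A B : Wff C α) (D E : Wff C γ) : Prop :=
  Replace (fun _ _ => False) A B D E

theorem Replace.mono {P P' : Ty → ℕ → Prop} (h : ∀ β n, P' β n → P β n) {α : Ty} {A B : Wff C α} :
    ∀ {γ : Ty} {D E : Wff C γ}, Replace P A B D E → Replace P' A B D E
  | _, _, _, .here => .here
  | _, _, _, .appLeft D r => .appLeft D (r.mono h)
  | _, _, _, .appRight F r => .appRight F (r.mono h)
  | _, _, _, .lam β n hn r => .lam β n (fun h' => hn (h β n h')) (r.mono h)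

section Rep

variable {α γ : Ty} {A B : Wff C α}

theorem Rep.eqL {D D' : Wff C γ} (E : Wff C γ) (h : Rep A B D D') :
    Rep A B (eq D E) (eq D' E) := .appLeft _ (.appRight _ h)

theorem Rep.eqR {D D' : Wff C γ} (E : Wff C γ) (h : Rep A B D D') :
    Rep A B (eq E D) (eq E D') := .appRight _ h

theorem Rep.dn {D D' : Wff C γ} (k : ℕ) (h : Rep A B D D') : Rep A B (dn k D) (dn k D') :=
  .appRight _ (.appRight _ (.lam _ _ id (.appRight _ (.appRight _ h))))

end Rep

variable {H : Set (Wff C o)}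

/-- No variable is free in a sentence, so the side condition of R1 never excludes an occurrence. -/
theorem Proves.rep [hH : Fact (AreSentences H)] {α : Ty} {A B : Wff C α} {k l} {D E : Wff C o}
    (h : Proves H (qeq A B k l)) (hD : Proves H D) (r : Rep A B D E) : Proves H E :=
  h.R1 hD (r.mono fun β n ⟨⟨G, hG, hG'⟩, _⟩ => hH.out G hG β n hG')

variable (H) in
/-- The wffs `A` and `B` can be replaced by each other in proofs from `H`. -/
def Rw {α : Ty} (A B : Wff C α) : Prop := ∃ k l, Proves H (qeq A B k l)

variable (H) in
/-- `H` proves that `A` is defined. -/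
def Df {α : Ty} (A : Wff C α) : Prop := ∃ k, Proves H (defd A k)

theorem Schema.proves {A : Wff C o} (h : Schema A) : Proves H A := .thm (.schema h)

theorem df_var {α : Ty} {n : ℕ} : Df H (var α n) :=
  ⟨freshOf _ _ _ le_rfl, (Schema.A5 _ _ _).proves⟩

theorem df_const {α : Ty} {c : PrimConst C α} : Df H (const c) :=
  ⟨freshOf _ _ _ le_rfl, (Schema.A6 _ _).proves⟩

theorem df_lam {α β : Ty} {n : ℕ} {A : Wff C α} : Df H (lam β n A) :=
  ⟨freshOf _ _ _ le_rfl, (Schema.A7 _ _ _ _).proves⟩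

/-- An abstraction never has type `o`, so A5, A6 and A8 cover all cases. -/
theorem defd_o : (A : Wff C o) → ∀ k, Proves H (defd A k)
  | var _ _ => fun k => (Schema.A5 _ _ k).proves
  | const _ => fun k => (Schema.A6 _ k).proves
  | app _ _ => fun k => (Schema.A8 _ _ k).proves

theorem df_o {A : Wff C o} : Df H A := ⟨freshOf _ _ _ le_rfl, defd_o A _⟩

/-- `defd` and `qeq` carry proofs of freshness that rewriting would have to transport. Formulas are
therefore handled as `dn` and `qn`, the same wffs with bare numbers, and freshness is restored only
at the end. -/
theorem rw_of_qn {α : Ty} {A B : Wff C α} {k l} (hk : A.bd ≤ k) (hl : B.bd ≤ l)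
    (h : Proves H (qn k l A B)) : Rw H A B := ⟨freshOf _ _ k hk, freshOf _ _ l hl, h⟩

/-- Beta-reduction. -/
theorem rw_beta {α β : Ty} {n : ℕ} {A : Wff C α} {B : Wff C β} (hA : Df H A)
    (h : FreeFor α n A B) : Rw H (Wff.app (Wff.lam α n B) A) (subst α n A B) := by
  obtain ⟨j, hj⟩ := hA
  exact ⟨_, _, Proves.R2 hj (Schema.A4 n A B h j (freshOf _ _ _ le_rfl)
    (freshOf _ _ _ le_rfl)).proves⟩

theorem rw_qn_eq {α : Ty} {A B : Wff C α} (hA : Df H A) (hB : Df H B) {k l : ℕ}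
    (hk : ¬ A.Occurs α k) (hl : ¬ B.Occurs α l) : Rw H (Wff.qn k l A B) (Wff.eq A B) := by
  obtain ⟨i, hi⟩ := hA
  obtain ⟨j, hj⟩ := hB
  exact ⟨_, _, Proves.R2 hj (Proves.R2 hi (Schema.A11 A B i j ⟨k, hk⟩ ⟨l, hl⟩
    (freshOf _ _ _ le_rfl) (freshOf _ _ _ le_rfl)).proves)⟩

variable [hH : Fact (AreSentences H)]

/-- Reflexivity is not an axiom. The redex `Y = [λz X]z` satisfies `Y ≃ X` by A4, and using this
quasi-equation to rewrite both occurrences of `Y` in itself leaves `X ≃ X`. -/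
theorem proves_qn_self {α : Ty} (X : Wff C α) (k l : Fresh α X) : Proves H (qn k.1 l.1 X X) := by
  -- `z` may occur in `X`, since it is substituted for itself; it only has to differ from `k` and
  -- `l`, so that these stay fresh for `Y`.
  set z := max (k.1 + 1) (l.1 + 1)
  set Y : Wff C α := app (lam o z X) (var o z)
  have hz : ∀ i : Fresh α X, i.1 < z → ¬ Y.Occurs α i.1 := by
    rintro ⟨i, hi⟩ hiz ((⟨-, h⟩ | h) | h)
    · exact absurd h (ne_of_gt hiz)
    · exact hi h
    · exact absurd h.2 (ne_of_gt hiz)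
  have hX : subst o z (var o z) X = X := subst_self X
  have h1 : Proves H (qn k.1 l.1 Y X) := by
    have := (Schema.A4 z (var o z) X (freeFor_self X) (freshOf _ _ _ le_rfl)
      (⟨k.1, hz k (by simp only [z]; omega)⟩ : Fresh α Y) ⟨l.1, by rw [hX]; exact l.2⟩).proves (H := H)
    have := Proves.R2 (defd_o _ _) this
    change Proves H (qn k.1 l.1 Y (subst o z (var o z) X)) at this
    rwa [hX] at this
  have h2 : Proves H (qn k.1 l.1 X X) := by
    let k' : Fresh α Y := ⟨k.1, hz k (by simp only [z]; omega)⟩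
    have h1' : Proves H (qeq Y X k' l) := h1
    have h3 : Proves H (imp (or (dn k.1 X) (dn l.1 X)) (eq Y X)) :=
      h1'.rep h1 (.appLeft _ (.appRight _ (.appLeft _ (.appRight _ (Rep.dn _ .here)))))
    exact h1'.rep h3 (.appRight _ (Rep.eqL _ .here))
  exact h2

theorem Rw.refl {α : Ty} (X : Wff C α) : Rw H X X :=
  ⟨freshOf _ _ _ le_rfl, freshOf _ _ _ le_rfl, proves_qn_self X _ _⟩

theorem Rw.of_eq {α : Ty} {X Y : Wff C α} (h : X = Y) : Rw H X Y := h ▸ Rw.refl X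

theorem Rw.rep {α : Ty} {A B : Wff C α} {D E : Wff C o} (h : Rw H A B) (hD : Proves H D)
    (r : Rep A B D E) : Proves H E := by
  obtain ⟨k, l, h⟩ := h; exact h.rep hD r

theorem Rw.symm {α : Ty} {X Y : Wff C α} (h : Rw H X Y) : Rw H Y X := by
  let p := max X.bd Y.bd
  have h1 : Proves H (qn p p X X) :=
    proves_qn_self X (freshOf _ _ p (le_max_left _ _)) (freshOf _ _ p (le_max_left _ _))
  have h2 : Proves H (imp (or (dn p Y) (dn p X)) (eq X X)) :=
    h.rep h1 (.appLeft _ (.appRight _ (.appLeft _ (.appRight _ (Rep.dn _ .here)))))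
  have h3 : Proves H (qn p p Y X) := h.rep h2 (.appRight _ (Rep.eqL _ .here))
  exact rw_of_qn (le_max_right _ _) (le_max_left _ _) h3

/-- This gives control over the bound variables hidden in `Rw`: rewriting the left-hand side of `Y ≃
Y` backwards keeps the chosen numbers, which need not even be fresh for `X`. -/
theorem Rw.proves_qn {α : Ty} {X Y : Wff C α} (h : Rw H X Y) (k l : Fresh α Y) :
    Proves H (qn k.1 l.1 X Y) := by
  have h1 := proves_qn_self (H := H) Y k l
  have h2 : Proves H (imp (or (dn k.1 X) (dn l.1 Y)) (eq Y Y)) :=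
    h.symm.rep h1 (.appLeft _ (.appRight _ (.appLeft _ (.appRight _ (Rep.dn _ .here)))))
  exact h.symm.rep h2 (.appRight _ (Rep.eqL _ .here))

/-- Rewriting inside the right-hand side of `D ≃ D`, possibly under binders, turns it into `D ≃ E`.
-/
theorem Rw.congr {α γ : Ty} {A B : Wff C α} {D E : Wff C γ} (h : Rw H A B) (r : Rep A B D E) :
    Rw H D E := by
  let p := max D.bd E.bd
  have h1 : Proves H (qn p p D D) :=
    proves_qn_self D (freshOf _ _ p (le_max_left _ _)) (freshOf _ _ p (le_max_left _ _))
  have h2 : Proves H (imp (or (dn p D) (dn p E)) (eq D D)) :=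
    h.rep h1 (.appLeft _ (.appRight _ (.appRight _ (Rep.dn _ r))))
  exact rw_of_qn (le_max_left _ _) (le_max_right _ _) (h.rep h2 (.appRight _ (Rep.eqR _ r)))

theorem Rw.trans {α : Ty} {X Y Z : Wff C α} (h : Rw H X Y) (h' : Rw H Y Z) : Rw H X Z := by
  let p := max X.bd (max Y.bd Z.bd)
  have hY : Y.bd ≤ p := (le_max_left _ _).trans (le_max_right _ _)
  have hZ : Z.bd ≤ p := (le_max_right _ _).trans (le_max_right _ _)
  have h1 : Proves H (qn p p X Y) := h.proves_qn (freshOf _ _ p hY) (freshOf _ _ p hY)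
  have h2 : Proves H (imp (or (dn p X) (dn p Z)) (eq X Y)) :=
    h'.rep h1 (.appLeft _ (.appRight _ (.appRight _ (Rep.dn _ .here))))
  exact rw_of_qn (le_max_left _ _) hZ (h'.rep h2 (.appRight _ (Rep.eqR _ .here)))

theorem Rw.mp {A B : Wff C o} (h : Rw H A B) (hA : Proves H A) : Proves H B := h.rep hA .here

theorem Rw.app {α β : Ty} {F F' : Wff C (fn α β)} {A A' : Wff C β} (h : Rw H F F')
    (h' : Rw H A A') : Rw H (app F A) (app F' A') :=
  (h.congr (.appLeft _ .here)).trans (h'.congr (.appRight _ .here))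

theorem Rw.lam {α : Ty} {A A' : Wff C α} (β : Ty) (n : ℕ) (h : Rw H A A') :
    Rw H (lam β n A) (lam β n A') := h.congr (.lam _ _ id .here)

theorem Rw.eq {α : Ty} {A A' B B' : Wff C α} (h : Rw H A A') (h' : Rw H B B') :
    Rw H (eq A B) (eq A' B') := ((Rw.refl _).app h).app h'

theorem Rw.and {A A' B B' : Wff C o} (h : Rw H A A') (h' : Rw H B B') :
    Rw H (and A B) (and A' B') := ((Rw.refl _).app h).app h'

theorem Rw.or {A A' B B' : Wff C o} (h : Rw H A A') (h' : Rw H B B') :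
    Rw H (or A B) (or A' B') := ((Rw.refl _).app h).app h'

theorem Rw.imp {A A' B B' : Wff C o} (h : Rw H A A') (h' : Rw H B B') :
    Rw H (imp A B) (imp A' B') := ((Rw.refl _).app h).app h'

theorem Rw.not {A A' : Wff C o} (h : Rw H A A') : Rw H (not A) (not A') := (Rw.refl _).app h

theorem Rw.all {A A' : Wff C o} (β : Ty) (n : ℕ) (h : Rw H A A') :
    Rw H (all β n A) (all β n A') := (Rw.refl _).eq (h.lam β n)

theorem Rw.dn {α : Ty} {A A' : Wff C α} (k : ℕ) (h : Rw H A A') : Rw H (dn k A) (dn k A') :=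
  (((Rw.refl _).eq h).not.all _ _).not

theorem Rw.qn {α : Ty} {A A' B B' : Wff C α} (k l : ℕ) (h : Rw H A A') (h' : Rw H B B') :
    Rw H (qn k l A B) (qn k l A' B') := ((h.dn k).or (h'.dn l)).imp (h.eq h')

/-- Substitution in quasi-equations. -/
theorem Rw.subst {α β : Ty} {n : ℕ} {A : Wff C α} {L R : Wff C β} (h : Rw H L R) (hA : Df H A)
    (hL : FreeFor α n A L) (hR : FreeFor α n A R) :
    Rw H (subst α n A L) (subst α n A R) :=
  (rw_beta hA hL).symm.trans (((h.lam α n).app (Rw.refl A)).trans (rw_beta hA hR))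

/-- By A11, `=` and `≃` are interchangeable between defined wffs. -/
theorem proves_eq_iff {α : Ty} {A B : Wff C α} (hA : Df H A) (hB : Df H B) :
    Proves H (Wff.eq A B) ↔ Rw H A B := by
  constructor
  · intro h
    exact rw_of_qn le_rfl le_rfl
      ((rw_qn_eq hA hB (not_occurs_of_bd_le le_rfl) (not_occurs_of_bd_le le_rfl)).symm.mp h)
  · intro h
    obtain ⟨k, l, h'⟩ := h
    exact (rw_qn_eq hA hB k.2 l.2).mp h'

end Wff

end Q0u

namespace Q0u

open Ty

theorem Ty.fn_ne_left (α β : Ty) : fn α β ≠ α := fun h => by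
  have := congrArg sizeOf h; simp at this; omega

theorem Ty.fn_ne_right (α β : Ty) : fn α β ≠ β := fun h => by
  have := congrArg sizeOf h; simp at this

namespace Wff

variable {C : Ty → Type u}

variable {H : Set (Wff C o)} [hH : Fact (AreSentences H)]

/-! ### Extensionality and conversion -/

theorem rw_of_eq_o {A B : Wff C o} (h : Proves H (eq A B)) : Rw H A B :=
  (proves_eq_iff df_o df_o).1 h

omit hH in
theorem rw_beta_self {α β : Ty} {n : ℕ} (B : Wff C β) :
    Rw H (app (lam α n B) (var α n)) B := by
  have := rw_beta (H := H) (df_var (α := α) (n := n)) (freeFor_self B)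
  rwa [subst_self] at this

variable (H) in
/-- Extensionality with the quantified variable numbered `v`, for the variables `f` and `g`. -/
def ExtVar (α β : Ty) (v : ℕ) : Prop := ∀ k, 3 < k → v < k →
  Rw H (eq (vf (fn α β)) (vg (fn α β)))
    (all β v (qn k k (app (vf (fn α β)) (var β v)) (app (vg (fn α β)) (var β v))))

omit hH in
theorem not_occurs_app_var {α β : Ty} {n v k : ℕ} (h : k ≠ v) :
    ¬ (app (var (fn α β) n) (var β v) : Wff C α).Occurs α k := by
  rintro (h' | h')
  · exact fn_ne_left _ _ h'.1
  · exact h h'.2.symm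

theorem extVar_three (α β : Ty) : ExtVar H α β 3 := fun k hk _ =>
  rw_of_eq_o (Schema.A3 α β ⟨k, not_occurs_app_var hk.ne'⟩ ⟨k, not_occurs_app_var hk.ne'⟩).proves

theorem ExtVar.rw {α β : Ty} {v k : ℕ} (h : ExtVar H α β v) {F G : Wff C (fn α β)}
    (hF : Df H F) (hG : Df H G) (hFv : ¬ F.Free β v) (hGv : ¬ G.Free β v)
    (hk : 3 < k) (hv : v < k) (hFk : ¬ F.Free α k) (hGk : ¬ G.Free α k) :
    Rw H (eq F G) (all β v (qn k k (app F (var β v)) (app G (var β v)))) := by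
  have e1 := fn_ne_left α β
  have e2 := fn_ne_right α β
  -- `f` and `g` are first moved to the variables `p` and `p + 1`, which do not occur in `F` or `G`;
  -- otherwise substituting `G` for `g` could alter the `F` already inserted. The `2` keeps `p`
  -- apart from the numbers of `f` and `g`.
  obtain ⟨p, hp⟩ : ∃ p, p = max 2 (max F.bd G.bd) := ⟨_, rfl⟩
  have key : ∀ (X Y : Wff C (fn α β)) (D : Wff C (fn α β)) (n : ℕ), Df H D →
      ¬ D.Free β v → ¬ D.Free α k →
      FreeFor _ n D X → FreeFor _ n D Y →
      Rw H (eq X Y) (all β v (qn k k (app X (var β v)) (app Y (var β v)))) →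
      Rw H (eq (subst _ n D X) (subst _ n D Y))
        (all β v (qn k k (app (subst _ n D X) (var β v)) (app (subst _ n D Y) (var β v)))) := by
    intro X Y D n hD h1 h2 hX hY hXY
    have := hXY.subst hD (n := n) (by simp [hX, hY])
      (freeFor_all h1 (freeFor_qn h2 h2 (by simp [hX]) (by simp [hY])))
    rwa [subst_eq, subst_all _ (by simp [e2.symm]),
      subst_qn _ _ (by simp [e1.symm]) (by simp [e1.symm]), subst_app, subst_app,
      subst_var_ne (by simp [e2])] at this
  have h1 := key _ _ (var (fn α β) p) 0 df_var (by simp [e2]) (by simp [e1])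
    (by simp [vf]) (by simp [vg]) (h k hk hv)
  have h2 := key _ _ (var (fn α β) (p + 1)) 1 df_var (by simp [e2]) (by simp [e1])
    (by simp [vf]) (by rw [vg, subst_var_ne (by simp)]; simp) h1
  rw [vf, vg, subst_var, subst_var_ne (γ := fn α β) (m := 1) (by simp), subst_var,
    subst_var_ne (by simp; omega)] at h2
  have h3 := key _ _ F p hF hFv hFk (by simp) (by simp) h2
  rw [subst_var, subst_var_ne (by simp)] at h3
  have hFp : ¬ F.Free (fn α β) (p + 1) := not_free_of_bd_le (by omega)
  have h4 := key _ _ G (p + 1) hG hGv hGk (freeFor_of_not_free hFp) (by simp) h3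
  rwa [subst_var, subst_of_not_free hFp] at h4

/-- By extensionality `F = F` and `F = G` unfold to quantified quasi-equations that differ only in
`F v` against `G v`, so the hypothesis carries the first into the second. -/
theorem ExtVar.ext {α β : Ty} {v : ℕ} (h : ExtVar H α β v) {F G : Wff C (fn α β)}
    (hF : Df H F) (hG : Df H G) (hFv : ¬ F.Free β v) (hGv : ¬ G.Free β v)
    (hFG : Rw H (app F (var β v)) (app G (var β v))) : Rw H F G := by
  obtain ⟨k, hk⟩ : ∃ k, k = max (v + 4) (max F.bd G.bd) := ⟨_, rfl⟩
  have hFk : ¬ F.Free α k := not_free_of_bd_le (by omega)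
  have hGk : ¬ G.Free α k := not_free_of_bd_le (by omega)
  have hk3 : 3 < k := by omega
  have hkv : v < k := by omega
  have h1 := h.rw hF hF hFv hFv hk3 hkv hFk hFk
  have h2 := h.rw hF hG hFv hGv hk3 hkv hFk hGk
  exact (proves_eq_iff hF hG).1 ((h1.trans (((Rw.refl _).qn k k hFG).all β v) |>.trans h2.symm).mp
    ((proves_eq_iff hF hF).2 (Rw.refl _)))

/-- A3 is stated only for the bound variable `x`. The change to another variable is a quasi-equality
of two abstractions of type `oβ`, which follows from A3 itself, at that type, and β-reduction. -/
theorem extVar (α β : Ty) (w : ℕ) : ExtVar H α β w := by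
  by_cases hw : w = 3
  · subst hw; exact extVar_three α β
  intro k hk hwk
  have e1 := fn_ne_left α β
  have e2 := fn_ne_right α β
  refine (extVar_three α β k hk hk).trans ((Rw.refl _).eq ?_)
  let body (b : ℕ) : Wff C o :=
    qn k k (app (vf (fn α β)) (var β b)) (app (vg (fn α β)) (var β b))
  have hsub : subst β w (var β 3) (body w) = body 3 := by
    simp only [body]
    rw [subst_qn _ _ (by simp; omega) (by simp; omega)]
    simp [vf, vg, subst_var_ne, e2.symm]
  have hfree : FreeFor β w (var β 3) (body w) :=
    freeFor_qn (by simp; omega) (by simp; omega) (by simp [vf]) (by simp [vg])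
  refine (extVar_three o β).ext df_lam df_lam (by simp) ?_ ((rw_beta_self _).trans ?_)
  · simp [vf, vg, e2, hw]
  · have := rw_beta (H := H) df_var hfree
    rw [hsub] at this
    exact this.symm

theorem rw_ext {α β : Ty} {v k : ℕ} {F G : Wff C (fn α β)}
    (hF : Df H F) (hG : Df H G) (hFv : ¬ F.Free β v) (hGv : ¬ G.Free β v)
    (hk : 3 < k) (hv : v < k) (hFk : ¬ F.Free α k) (hGk : ¬ G.Free α k) :
    Rw H (eq F G) (all β v (qn k k (app F (var β v)) (app G (var β v)))) :=
  (extVar α β v).rw hF hG hFv hGv hk hv hFk hGk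

theorem Rw.ext {α β : Ty} (v : ℕ) {F G : Wff C (fn α β)}
    (hF : Df H F) (hG : Df H G) (hFv : ¬ F.Free β v) (hGv : ¬ G.Free β v)
    (hFG : Rw H (Wff.app F (var β v)) (Wff.app G (var β v))) : Rw H F G :=
  (extVar α β v).ext hF hG hFv hGv hFG

theorem rw_alpha {α β : Ty} {n m : ℕ} {A : Wff C α} (hm : ¬ A.Free β m)
    (hf : FreeFor β n (var β m) A) : Rw H (lam β n A) (lam β m (subst β n (var β m) A)) := by
  obtain rfl | hnm := eq_or_ne n m
  · rw [subst_self]; exact Rw.refl _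
  exact Rw.ext m df_lam df_lam (fun h => hm h.2) (by simp)
    ((rw_beta df_var hf).trans (rw_beta_self _).symm)

theorem rw_eta {α β : Ty} {n : ℕ} {F : Wff C (fn α β)} (hF : Df H F) (hn : ¬ F.Free β n) :
    Rw H (lam β n (app F (var β n))) F :=
  Rw.ext n df_lam hF (by simp) hn (rw_beta_self _)

/-! ### Truth values -/

theorem proves_tru : Proves H tru := (proves_eq_iff df_const df_const).2 (Rw.refl _)

theorem rw_lam_tru {β : Ty} (n m : ℕ) : Rw H (lam β n tru) (lam β m tru) := by
  refine Rw.ext 0 df_lam df_lam (by simp) (by simp) ?_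
  have h (k : ℕ) : Rw H (app (lam β k tru) (var β 0)) (tru : Wff C o) := by
    have := rw_beta (H := H) (n := k) (df_var (α := β) (n := 0)) (freeFor_tru (C := C))
    rwa [subst_tru] at this
  exact (h n).trans (h m).symm

/-- Universal instantiation. -/
theorem rw_tru_of_all {α : Ty} {n : ℕ} {B : Wff C o} {A : Wff C α} (h : Proves H (all α n B))
    (hA : Df H A) (hf : FreeFor α n A B) : Rw H tru (subst α n A B) := by
  have h1 : Rw H (lamy α tru) (lam α n B) := (proves_eq_iff df_lam df_lam).1 h
  have h2 := rw_beta (n := 4) hA (freeFor_tru (C := C))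
  rw [subst_tru] at h2
  exact h2.symm.trans ((h1.app (Rw.refl A)).trans (rw_beta hA hf))

/-- That provable sentences can be exchanged with `T` is not yet known. For the identity function
`I`, however, `I = I` unfolds to `∀x [I x ≃ I x]`, and the definition of `∀` yields `T ≃ [x = x]` on
instantiation. -/
theorem rw_tru_eq_self {α : Ty} {A : Wff C α} (hA : Df H A) : Rw H tru (eq A A) := by
  let I : Wff C (fn α α) := lam α 0 (var α 0)
  have h1 : Proves H (all α 0 (qn 4 4 (app I (var α 0)) (app I (var α 0)))) :=
    (rw_ext df_lam df_lam (by simp) (by simp) (by simp) (by simp) (by simp)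
      (by simp)).mp ((proves_eq_iff (A := I) df_lam df_lam).2 (Rw.refl _))
  have h2 := rw_tru_of_all h1 df_var (freeFor_self _)
  rw [subst_self] at h2
  have h3 : Rw H tru (eq (var α 0) (var α 0)) := h2.trans
    (((rw_beta_self _).qn 4 4 (rw_beta_self _)).trans
      (rw_qn_eq df_var df_var (by simp [Occurs]) (by simp [Occurs])))
  simpa using h3.subst hA (n := 0) (by simp) (by simp)

theorem rw_all_of_truth_values {n : ℕ} {B : Wff C o} (hT : FreeFor o n tru B)
    (hF : FreeFor o n fls B) : Rw H (and (subst o n tru B) (subst o n fls B)) (all o n B) := by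
  have h1 : Rw H (and (app (vg (fn o o)) tru) (app (vg (fn o o)) fls))
      (all o 3 (app (vg (fn o o)) (vx o))) := rw_of_eq_o Schema.A1.proves
  -- The η-step removes the binder of A1, so that substituting `[λ B]` for `g` cannot capture a
  -- variable of `B`.
  have h2 : Rw H (and (app (vg (fn o o)) tru) (app (vg (fn o o)) fls))
      (eq (lamy o tru) (vg (fn o o))) :=
    h1.trans ((Rw.refl _).eq (rw_eta df_var (by simp [vg])))
  have h3 := h2.subst (A := lam o n B) (n := 1) df_lam (by simp [vg])
    (by simpa [vg] using freeFor_of_not_free (by simp [lamy]))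
  have h4 : subst (fn o o) 1 (lam o n B) (lamy o tru) = lamy o tru :=
    subst_of_not_free (by simp [lamy])
  simp only [vg, subst_and, subst_app, subst_var, subst_tru, subst_fls, subst_eq, h4] at h3
  exact ((rw_beta df_o hT).and (rw_beta df_o hF)).symm.trans h3

omit hH in
theorem freeFor_closed {α β : Ty} {n : ℕ} {A : Wff C α} {B : Wff C β} (h : A.Closed) :
    FreeFor α n A B := freeFor_of_bound fun γ m _ => h γ m

omit hH in
theorem closed_tru : (tru : Wff C o).Closed := fun _ _ => by simp

theorem rw_and_tru_tru : Rw H (and tru tru) (tru : Wff C o) := by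
  let G (X Y : Wff C o) : Wff C (fn o (fn (fn o o) o)) :=
    lamg (fn (fn o o) o) (app (app (vg (fn (fn o o) o)) X) Y)
  have h1 : Rw H (app andC tru) (lamy o (eq (G tru tru) (G tru (vy o)))) :=
    rw_beta (H := H) (n := 3) (A := (tru : Wff C o))
      (B := lamy o (eq (G tru tru) (G (vx o) (vy o)))) df_o (freeFor_closed closed_tru)
  have h2 : Rw H (app (lamy o (eq (G tru tru) (G tru (vy o)))) tru)
      (eq (G tru tru) (G tru tru)) :=
    rw_beta (H := H) (n := 4) (A := (tru : Wff C o))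
      (B := eq (G tru tru) (G tru (vy o))) df_o (freeFor_closed closed_tru)
  exact ((h1.app (Rw.refl _)).trans h2).trans (rw_tru_eq_self df_lam).symm

theorem proves_and_of_rw {A B : Wff C o} (hA : Rw H tru A) (hB : Rw H tru B) :
    Proves H (and A B) :=
  (hA.and hB).mp (rw_and_tru_tru.symm.mp proves_tru)

theorem proves_eq_of_rw {α : Ty} {A B : Wff C α} (hA : Df H A) (h : Rw H A B) :
    Rw H tru (eq A B) := (rw_tru_eq_self hA).trans ((Rw.refl A).eq h)

/-- A1 for the identity function: `∀x x` is `F` up to renaming a bound variable. -/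
theorem rw_and_tru_fls : Rw H (and tru fls) (fls : Wff C o) := by
  have := rw_all_of_truth_values (H := H) (n := 3) (B := vx o) (by simp [vx]) (by simp [vx])
  simp only [vx, subst_var] at this
  exact this.trans ((rw_lam_tru _ _).eq (Rw.refl _))

theorem rw_tru_and (A : Wff C o) : Rw H (and tru A) A := by
  have h := rw_all_of_truth_values (H := H) (n := 0) (B := eq (and tru (var o 0)) (var o 0))
    (by simp) (by simp)
  simp only [subst_eq, subst_and, subst_tru, subst_var] at h
  have h1 := h.mp (proves_and_of_rw (proves_eq_of_rw df_o rw_and_tru_tru)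
    (proves_eq_of_rw df_o rw_and_tru_fls))
  have h2 := rw_tru_of_all (A := A) h1 df_o (by simp)
  simp only [subst_eq, subst_and, subst_tru, subst_var] at h2
  exact rw_of_eq_o (h2.mp proves_tru)

/-- Both sides are `∀x [T = x]`: `F` by extensionality applied to its definition, and `T = F`
because A1 turns the quantifier into `[T = T] ∧ [T = F]`. -/
theorem rw_eq_tru_fls : Rw H (eq tru fls) (fls : Wff C o) := by
  have h := rw_all_of_truth_values (H := H) (n := 3) (B := eq tru (var o 3)) (by simp) (by simp)
  simp only [subst_eq, subst_tru, subst_var] at h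
  have h1 : Rw H fls (all o 3 (qn 4 4 (app (lamx o tru) (var o 3)) (app (lamx o (vx o)) (var o 3)))) :=
    rw_ext df_lam df_lam (by simp [lamx]) (by simp [lamx, vx]) (by simp) (by simp)
      (by simp [lamx]) (by simp [lamx, vx])
  have h2 := h1.trans (((((rw_beta_self _).qn 4 4 (rw_beta_self _))).trans
    (rw_qn_eq df_o df_o (by simp [tru, eq, Q, Occurs]) (by simp [vx, Occurs]))).all _ _)
  exact ((h2.trans h.symm).trans (((rw_tru_eq_self df_o).symm.and (Rw.refl _)).trans
    (rw_tru_and _))).symm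

theorem rw_tru_eq (A : Wff C o) : Rw H (eq tru A) A := by
  have h := rw_all_of_truth_values (H := H) (n := 0) (B := eq (eq tru (var o 0)) (var o 0))
    (by simp) (by simp)
  simp only [subst_eq, subst_tru, subst_var] at h
  have h1 := h.mp (proves_and_of_rw (proves_eq_of_rw df_o (rw_tru_eq_self df_o).symm)
    (proves_eq_of_rw df_o rw_eq_tru_fls))
  have h2 := rw_tru_of_all (A := A) h1 df_o (by simp)
  simp only [subst_eq, subst_tru, subst_var] at h2
  exact rw_of_eq_o (h2.mp proves_tru)

theorem rw_tru_iff {A : Wff C o} : Rw H tru A ↔ Proves H A :=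
  ⟨fun h => h.mp proves_tru, fun h => rw_of_eq_o ((rw_tru_eq A).symm.mp h)⟩

theorem Proves.gen {A : Wff C o} (h : Proves H A) (β : Ty) (n : ℕ) : Proves H (all β n A) :=
  (proves_eq_iff df_lam df_lam).2 ((rw_lam_tru 4 n).trans ((rw_tru_iff.2 h).lam β n))

theorem Proves.inst {α : Ty} {n : ℕ} {B : Wff C o} {A : Wff C α} (h : Proves H (all α n B))
    (hA : Df H A) (hf : FreeFor α n A B) : Proves H (Wff.subst α n A B) :=
  rw_tru_iff.1 (rw_tru_of_all h hA hf)

theorem Proves.subst {α : Ty} {n : ℕ} {B : Wff C o} {A : Wff C α} (h : Proves H B)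
    (hA : Df H A) (hf : FreeFor α n A B) : Proves H (Wff.subst α n A B) :=
  (h.gen α n).inst hA hf

/-- Proof by cases on a truth value. -/
theorem Proves.cases {n : ℕ} {B A : Wff C o} (hTf : FreeFor o n tru B) (hFf : FreeFor o n fls B)
    (hT : Proves H (Wff.subst o n tru B)) (hF : Proves H (Wff.subst o n fls B))
    (hf : FreeFor o n A B) : Proves H (Wff.subst o n A B) :=
  ((rw_all_of_truth_values hTf hFf).mp
    (proves_and_of_rw (rw_tru_iff.2 hT) (rw_tru_iff.2 hF))).inst df_o hf

end Wff

end Q0u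

namespace Q0u

open Ty

namespace Wff

variable {C : Ty → Type u} {H : Set (Wff C o)} [hH : Fact (AreSentences H)]

/-! ### Truth tables -/

/-- Direct β-reduction at `X` could capture a free `y` of `X`, so the abbreviation is unfolded at
fresh variables, for which `X` and `Y` are then substituted. -/
theorem rw_imp (X Y : Wff C o) : Rw H (imp X Y) (eq X (and X Y)) := by
  obtain ⟨p, hp⟩ : ∃ p, p = max 5 (max X.bd Y.bd) := ⟨_, rfl⟩
  have h1 : Rw H (app impC (var o p)) (lamy o (eq (var o p) (and (var o p) (vy o)))) := by
    have := rw_beta (H := H) (n := 3) (A := var o p)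
      (B := lamy o (eq (vx o) (and (vx o) (vy o)))) df_o
      (freeFor_lam (by simp; omega) (by simp [vx, vy]))
    simpa [impC, lamx, lamy, subst_lam, vx, vy, subst_var_ne] using this
  have h2 : Rw H (imp (var o p) (var o (p + 1)))
      (eq (var o p) (and (var o p) (var o (p + 1)))) := by
    have := rw_beta (H := H) (n := 4) (A := var o (p + 1))
      (B := eq (var o p) (and (var o p) (vy o))) df_o (by simp [vy])
    rw [subst_eq, subst_and, subst_var_ne (by simp; omega), vy, subst_var] at this
    exact (h1.app (Rw.refl _)).trans this
  have h3 := h2.subst (A := X) (n := p) df_o (by simp) (by simp)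
  simp only [subst_eq, subst_and, subst_imp, subst_var] at h3
  rw [subst_var_ne (by simp)] at h3
  have hX : ¬ X.Free o (p + 1) := not_free_of_bd_le (by omega)
  have h4 := h3.subst (A := Y) (n := p + 1) df_o (by simp [freeFor_of_not_free hX])
    (by simp [freeFor_of_not_free hX])
  simpa only [subst_eq, subst_and, subst_imp, subst_var, subst_of_not_free hX] using h4

theorem rw_or (X Y : Wff C o) : Rw H (or X Y) (not (and (not X) (not Y))) := by
  obtain ⟨p, hp⟩ : ∃ p, p = max 5 (max X.bd Y.bd) := ⟨_, rfl⟩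
  have h1 : Rw H (app orC (var o p)) (lamy o (not (and (not (var o p)) (not (vy o))))) := by
    have := rw_beta (H := H) (n := 3) (A := var o p)
      (B := lamy o (not (and (not (vx o)) (not (vy o))))) df_o
      (freeFor_lam (by simp; omega) (by simp [vx, vy]))
    simpa [orC, lamx, lamy, subst_lam, vx, vy, subst_var_ne] using this
  have h2 : Rw H (or (var o p) (var o (p + 1)))
      (not (and (not (var o p)) (not (var o (p + 1))))) := by
    have := rw_beta (H := H) (n := 4) (A := var o (p + 1))
      (B := not (and (not (var o p)) (not (vy o)))) df_o (by simp [vy])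
    rw [subst_not, subst_and, subst_not, subst_var_ne (by simp; omega), subst_not, vy,
      subst_var] at this
    exact (h1.app (Rw.refl _)).trans this
  have h3 := h2.subst (A := X) (n := p) df_o (by simp) (by simp)
  simp only [subst_not, subst_and, subst_or, subst_var] at h3
  rw [subst_var_ne (by simp)] at h3
  have hX : ¬ X.Free o (p + 1) := not_free_of_bd_le (by omega)
  have h4 := h3.subst (A := Y) (n := p + 1) df_o (by simp [freeFor_of_not_free hX])
    (by simp [freeFor_of_not_free hX])
  simpa only [subst_not, subst_and, subst_or, subst_var, subst_of_not_free hX] using h4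

/-- Leibniz' law for defined wffs. -/
theorem proves_leibniz_of_df {α : Ty} {X Y : Wff C α} {G : Wff C (fn o α)} (hX : Df H X)
    (hY : Df H Y) (hG : Df H G) : Proves H (imp (eq X Y) (eq (app G X) (app G Y))) := by
  have e := fn_ne_right o α
  -- Moving `x` and `y` of A2 to numbers beyond all three wffs keeps the later substitutions
  -- independent; the `5` avoids the numbers of `h`, `x`, `y`.
  obtain ⟨p, hp⟩ : ∃ p, p = max 5 (max G.bd (max X.bd Y.bd)) := ⟨_, rfl⟩
  have h1 := (Schema.A2 (C := C) α).proves (H := H)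
  have h2 := h1.subst (α := α) (n := 3) (A := var α p) df_var (by simp [vx, vy, vh])
  rw [subst_imp, subst_eq, subst_eq, subst_app, subst_app, vx, vy, vh, subst_var,
    subst_var_ne (by simp), subst_var_ne (by simp [e.symm])] at h2
  have h3 := h2.subst (α := α) (n := 4) (A := var α (p + 1)) df_var (by simp)
  rw [subst_imp, subst_eq, subst_eq, subst_app, subst_app, subst_var,
    subst_var_ne (by simp; omega), subst_var_ne (by simp [e.symm])] at h3
  have h4 := h3.subst (α := fn o α) (n := 2) (A := G) hG (by simp)
  rw [subst_imp, subst_eq, subst_eq, subst_app, subst_app, subst_var,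
    subst_var_ne (by simp [e]), subst_var_ne (by simp [e])] at h4
  have hG1 : ¬ G.Free α p := not_free_of_bd_le (by omega)
  have hG2 : ¬ G.Free α (p + 1) := not_free_of_bd_le (by omega)
  have hX2 : ¬ X.Free α (p + 1) := not_free_of_bd_le (by omega)
  have h5 := h4.subst (α := α) (n := p) (A := X) hX (by simp [freeFor_of_not_free hG1])
  rw [subst_imp, subst_eq, subst_eq, subst_app, subst_app, subst_var,
    subst_var_ne (by simp), subst_of_not_free hG1] at h5
  have h6 := h5.subst (α := α) (n := p + 1) (A := Y) hY
    (by simp [freeFor_of_not_free hG2, freeFor_of_not_free hX2])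
  rwa [subst_imp, subst_eq, subst_eq, subst_app, subst_app, subst_var,
    subst_of_not_free hX2, subst_of_not_free hG2] at h6

theorem rw_tru_imp (X : Wff C o) : Rw H (imp tru X) X :=
  (rw_imp _ _).trans ((rw_tru_eq _).trans (rw_tru_and _))

/-- `F` is the equation `[λx T] = [λx x]`. Leibniz' law for evaluation at `X` derives `T = X` from
it, and this is interchangeable with `X`. -/
theorem proves_fls_imp (X : Wff C o) : Proves H (imp fls X) := by
  obtain ⟨p, hp⟩ : ∃ p, p = X.bd := ⟨_, rfl⟩
  have hX : ¬ X.Free (fn o o) p := not_free_of_bd_le (by omega)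
  have h1 := proves_leibniz_of_df (H := H) (X := lamx o tru) (Y := lamx o (vx o))
    (G := lam (fn o o) p (app (var (fn o o) p) X)) df_lam df_lam df_lam
  have h2 (Z : Wff C (fn o o)) (hZ : Df H Z) :
      Rw H (app (lam (fn o o) p (app (var (fn o o) p) X)) Z) (app Z X) := by
    have := rw_beta (n := p) (B := app (var (fn o o) p) X) hZ
      (by simp [freeFor_of_not_free hX])
    rwa [subst_app, subst_var, subst_of_not_free hX] at this
  have h3 : Rw H (app (lamx o tru) X) (tru : Wff C o) := by
    have := rw_beta (H := H) (n := 3) (A := X) df_o (freeFor_tru (C := C))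
    rwa [subst_tru] at this
  have h4 : Rw H (app (lamx o (vx o)) X) X := by
    have := rw_beta (H := H) (n := 3) (A := X) (B := vx o) df_o (by simp [vx])
    rwa [vx, subst_var] at this
  exact ((Rw.refl _).imp ((((h2 _ df_lam).trans h3).eq ((h2 _ df_lam).trans h4)).trans
    (rw_tru_eq X))).mp h1

theorem rw_fls_imp (X : Wff C o) : Rw H (imp fls X) tru := (rw_tru_iff.2 (proves_fls_imp X)).symm

theorem rw_fls_and (X : Wff C o) : Rw H (and fls X) fls :=
  (rw_of_eq_o ((rw_imp _ _).mp (proves_fls_imp X))).symm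

theorem rw_imp_tru (X : Wff C o) : Rw H (imp X tru) tru := by
  have := Proves.cases (H := H) (n := 0) (B := imp (var o 0) tru) (A := X) (by simp) (by simp)
    (by simpa using (rw_tru_imp _).symm.mp proves_tru) (by simpa using proves_fls_imp _) (by simp)
  exact (rw_tru_iff.2 (by simpa using this)).symm

/-- This is the truth table of negation at `T`. Leibniz' law for `[λz [z = F]]` gives `[F = T] ⊃ F`.
A case distinction proves `[x ⊃ F] ⊃ [F = x]`, which is then applied with `F = T` for `x`. -/
theorem rw_fls_eq_tru : Rw H (eq fls tru) (fls : Wff C o) := by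
  have h1 := proves_leibniz_of_df (H := H) (X := fls) (Y := tru)
    (G := lam o 0 (eq (var o 0) fls)) df_o df_o df_lam
  have h2 (Z : Wff C o) : Rw H (app (lam o 0 (eq (var o 0) fls)) Z) (eq Z fls) := by
    simpa using rw_beta (H := H) (n := 0) (A := Z) (B := eq (var o 0) fls) df_o (by simp)
  have h3 : Proves H (imp (eq fls tru) fls) := ((Rw.refl _).imp ((((h2 _).trans
    (rw_tru_eq_self df_o).symm).eq ((h2 _).trans rw_eq_tru_fls)).trans (rw_tru_eq _))).mp h1
  have h4 := Proves.cases (H := H) (n := 0) (B := imp (imp (var o 0) fls) (eq fls (var o 0)))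
    (A := eq fls tru) (by simp) (by simp)
    (by simpa using ((rw_tru_imp _).imp (Rw.refl _)).symm.mp (proves_fls_imp _))
    (by simpa using ((Rw.refl _).imp (rw_tru_eq_self df_o)).mp ((rw_imp_tru _).symm.mp proves_tru))
    (by simp)
  simp only [subst_imp, subst_eq, subst_var, subst_fls] at h4
  exact (rw_of_eq_o (h3.R2 h4)).symm

/-- The truth value of type `o` named by a Boolean. -/
def ofBool (b : Bool) : Wff C o := if b then tru else fls

theorem rw_not_ofBool : ∀ a, Rw H (not (ofBool a)) (ofBool (!a) : Wff C o)
  | true => rw_fls_eq_tru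
  | false => (rw_tru_eq_self df_o).symm

theorem rw_and_ofBool : ∀ a b, Rw H (and (ofBool a) (ofBool b)) (ofBool (a && b) : Wff C o)
  | true, _ => rw_tru_and _
  | false, _ => rw_fls_and _

theorem rw_imp_ofBool : ∀ a b, Rw H (imp (ofBool a) (ofBool b)) (ofBool (!a || b) : Wff C o)
  | true, _ => rw_tru_imp _
  | false, _ => rw_fls_imp _

theorem rw_eq_ofBool : ∀ a b, Rw H (eq (ofBool a) (ofBool b)) (ofBool (a == b) : Wff C o)
  | true, true => rw_tru_eq _
  | true, false => rw_tru_eq _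
  | false, true => rw_fls_eq_tru
  | false, false => (rw_tru_eq_self df_o).symm

theorem rw_or_ofBool (a b : Bool) :
    Rw H (or (ofBool a) (ofBool b)) (ofBool (a || b) : Wff C o) := by
  have := (rw_or _ _).trans ((((rw_not_ofBool a).and (rw_not_ofBool b)).trans
    (rw_and_ofBool _ _)).not.trans (rw_not_ofBool (H := H) (C := C) _))
  simpa using this

/-! ### Tautologies -/

/-- Propositional formulas with `n` atoms. -/
inductive PForm (n : ℕ) : Type
  | atom (i : Fin n)
  | not (a : PForm n)
  | and (a b : PForm n)
  | or (a b : PForm n)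
  | imp (a b : PForm n)
  | iff (a b : PForm n)

namespace PForm

variable {n : ℕ}

/-- The truth value of a propositional formula. -/
def eval (v : Fin n → Bool) : PForm n → Bool
  | atom i => v i
  | not a => !a.eval v
  | and a b => a.eval v && b.eval v
  | or a b => a.eval v || b.eval v
  | imp a b => !a.eval v || b.eval v
  | iff a b => a.eval v == b.eval v

/-- The wff obtained from a propositional formula by substituting wffs for the atoms. -/
def wff (s : Fin n → Wff C o) : PForm n → Wff C o
  | atom i => s i
  | not a => Wff.not (a.wff s)
  | and a b => Wff.and (a.wff s) (b.wff s)
  | or a b => Wff.or (a.wff s) (b.wff s)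
  | imp a b => Wff.imp (a.wff s) (b.wff s)
  | iff a b => Wff.eq (a.wff s) (b.wff s)

theorem rw_wff {s : Fin n → Wff C o} {v : Fin n → Bool} (h : ∀ i, s i = ofBool (v i)) :
    ∀ φ : PForm n, Rw H (φ.wff s) (ofBool (φ.eval v))
  | atom i => .of_eq (h i)
  | not a => (rw_wff h a).not.trans (rw_not_ofBool _)
  | and a b => ((rw_wff h a).and (rw_wff h b)).trans (rw_and_ofBool _ _)
  | or a b => ((rw_wff h a).or (rw_wff h b)).trans (rw_or_ofBool _ _)
  | imp a b => ((rw_wff h a).imp (rw_wff h b)).trans (rw_imp_ofBool _ _)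
  | iff a b => ((rw_wff h a).eq (rw_wff h b)).trans (rw_eq_ofBool _ _)

theorem freeFor_wff {s : Fin n → Wff C o} {β : Ty} {k : ℕ} {A : Wff C β}
    (h : ∀ i, FreeFor β k A (s i)) : ∀ φ : PForm n, FreeFor β k A (φ.wff s)
  | atom i => h i
  | not a => by simpa [wff] using freeFor_wff h a
  | and a b => by simpa [wff] using ⟨freeFor_wff h a, freeFor_wff h b⟩
  | or a b => by simpa [wff] using ⟨freeFor_wff h a, freeFor_wff h b⟩
  | imp a b => by simpa [wff] using ⟨freeFor_wff h a, freeFor_wff h b⟩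
  | iff a b => by simpa [wff] using ⟨freeFor_wff h a, freeFor_wff h b⟩

theorem subst_wff (s : Fin n → Wff C o) {β : Ty} {k : ℕ} {A : Wff C β} :
    ∀ φ : PForm n, subst β k A (φ.wff s) = φ.wff fun i => subst β k A (s i)
  | atom i => rfl
  | not a => by simp [wff, subst_wff s a]
  | and a b => by simp [wff, subst_wff s a, subst_wff s b]
  | or a b => by simp [wff, subst_wff s a, subst_wff s b]
  | imp a b => by simp [wff, subst_wff s a, subst_wff s b]
  | iff a b => by simp [wff, subst_wff s a, subst_wff s b]

/-- Induction on a set containing every atom whose wff need not be a truth value: put a fresh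
variable in place of one such atom and split it into the cases `T` and `F`. -/
theorem proves_wff {φ : PForm n} (hφ : ∀ v, φ.eval v = true) (t : Finset (Fin n)) :
    ∀ s : Fin n → Wff C o, (∀ i ∉ t, ∃ b, s i = ofBool b) → Proves H (φ.wff s) := by
  classical
  induction t using Finset.induction with
  | empty =>
    intro s hs
    choose v hv using fun i => hs i (Finset.notMem_empty i)
    have := rw_wff (H := H) hv φ
    rw [hφ] at this
    exact this.symm.mp proves_tru
  | insert j t _ ih =>
    intro s hs
    obtain ⟨p, hp⟩ : ∃ p, ∀ i, (s i).bd ≤ p :=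
      ⟨Finset.univ.sup fun i => (s i).bd, fun i => Finset.le_sup (f := fun i => (s i).bd)
        (Finset.mem_univ i)⟩
    have hfree (A : Wff C o) (i) : FreeFor o p A (Function.update s j (var o p) i) := by
      by_cases hij : i = j
      · subst hij; simp
      · rw [Function.update_of_ne hij]; exact freeFor_of_not_free (not_free_of_bd_le (hp i))
    have hsubst (A : Wff C o) : subst o p A (φ.wff (Function.update s j (var o p))) =
        φ.wff (Function.update s j A) := by
      rw [subst_wff]
      congr 1
      funext i
      by_cases hij : i = j
      · subst hij; simp
      · rw [Function.update_of_ne hij, Function.update_of_ne hij]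
        exact subst_of_not_free (not_free_of_bd_le (hp i))
    have key (b : Bool) : Proves H (φ.wff (Function.update s j (ofBool b))) := by
      refine ih _ fun i hi => ?_
      by_cases hij : i = j
      · subst hij; exact ⟨b, by simp⟩
      · rw [Function.update_of_ne hij]; exact hs i (by simp [hij, hi])
    have := Proves.cases (H := H) (A := s j) (freeFor_wff (hfree tru) φ)
      (freeFor_wff (hfree fls) φ) (by rw [hsubst]; exact key true)
      (by rw [hsubst]; exact key false) (freeFor_wff (hfree (s j)) φ)
    rwa [hsubst, Function.update_eq_self] at this

/-- Tautologies are provable. -/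
theorem taut (φ : PForm n) (s : Fin n → Wff C o) (hφ : ∀ v, φ.eval v = true) :
    Proves H (φ.wff s) := proves_wff hφ Finset.univ s fun i hi => absurd (Finset.mem_univ i) hi

end PForm

end Wff

end Q0u

namespace Q0u

open Ty

namespace Wff

variable {C : Ty → Type u} {H : Set (Wff C o)}

/-! ### Definedness -/

/-- `A↓`, with a canonical choice of the bound variable. -/
def dfd {α : Ty} (A : Wff C α) : Wff C o := dn A.bd A

/-- `A ≃ B`, with a canonical choice of the bound variables. -/
def qe {α : Ty} (A B : Wff C α) : Wff C o := imp (or (dfd A) (dfd B)) (eq A B)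

theorem proves_dfd_o (A : Wff C o) : Proves H (dfd A) := defd_o A (freshOf _ _ _ le_rfl)

variable [hH : Fact (AreSentences H)]

theorem rw_dn {α : Ty} {A : Wff C α} {k l : ℕ} (hk : ¬ A.Occurs α k) (hl : ¬ A.Occurs α l) :
    Rw H (dn k A) (dn l A) := by
  obtain rfl | hkl := eq_or_ne k l
  · exact Rw.refl _
  have hl' : ¬ A.Free α l := fun h => hl h.occurs
  have h := rw_alpha (H := H) (β := α) (n := k) (m := l) (A := not (eq (var α k) A))
    (by simp [hl', hkl]) (by simpa using freeFor_of_not_free fun h => hk h.occurs)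
  rw [subst_not, subst_eq, subst_var, subst_of_not_free fun h => hk h.occurs] at h
  exact ((Rw.refl _).eq h).not

theorem rw_dfd {α : Ty} {A : Wff C α} (k : Fresh α A) : Rw H (defd A k) (dfd A) :=
  rw_dn k.2 (not_occurs_of_bd_le le_rfl)

theorem df_iff {α : Ty} {A : Wff C α} : Df H A ↔ Proves H (dfd A) :=
  ⟨fun ⟨k, hk⟩ => (rw_dfd k).mp hk, fun h => ⟨freshOf _ _ _ le_rfl, h⟩⟩

theorem rw_qe {α : Ty} {A B : Wff C α} (k : Fresh α A) (l : Fresh α B) :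
    Rw H (qeq A B k l) (qe A B) := ((rw_dfd k).or (rw_dfd l)).imp (Rw.refl _)

theorem rw_qn_qe {α : Ty} {A B : Wff C α} {k l : ℕ} (hk : A.bd ≤ k) (hl : B.bd ≤ l) :
    Rw H (qn k l A B) (qe A B) := rw_qe (freshOf _ _ _ hk) (freshOf _ _ _ hl)

theorem Rw.qe {α : Ty} {A B : Wff C α} (h : Rw H A B) : Proves H (qe A B) := by
  obtain ⟨k, l, h⟩ := h; exact (rw_qe k l).mp h

open PForm

/-- Keeping definedness as an antecedent allows β-reduction at arguments not known to be defined.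
The equation may replace `≃` because an application of type `o` is always defined. -/
theorem proves_imp_dfd_beta {α : Ty} {n : ℕ} {A : Wff C α} {B : Wff C o}
    (h : FreeFor α n A B) : Proves H (imp (dfd A) (eq (app (lam α n B) A) (subst α n A B))) := by
  have h1 := (Schema.A4 n A B h (freshOf _ _ _ le_rfl) (freshOf _ _ _ le_rfl)
    (freshOf _ _ _ le_rfl)).proves (H := H)
  exact h1.R2 ((proves_dfd_o (app (lam α n B) A)).R2 (taut (.imp (.atom 0)
    (.imp (.imp (.atom 1) (.imp (.or (.atom 0) (.atom 2)) (.atom 3))) (.imp (.atom 1) (.atom 3))))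
    ![dfd (app (lam α n B) A), dfd A, dfd (subst α n A B), _] (by decide)))

/-- Instantiation with a wff that need not be defined. -/
theorem Proves.imp_subst {α : Ty} {n : ℕ} {A : Wff C α} {B : Wff C o} (hB : Proves H B)
    (h : FreeFor α n A B) : Proves H (imp (dfd A) (Wff.subst α n A B)) := by
  -- β-reduction is applied to the constant function `T`; its body is then rewritten to the provable
  -- `B`, and compared with the β-reduction of `[λ B] A`.
  have h1 := proves_imp_dfd_beta (H := H) (freeFor_tru (n := n) (D := A))
  rw [subst_tru] at h1
  have h2 := ((Rw.refl (dfd A)).imp ((((rw_tru_iff.2 hB).lam α n).app (Rw.refl A)).eq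
    (Rw.refl _))).mp h1
  exact (proves_imp_dfd_beta h).R2 (h2.R2 (proves_tru.R2 (taut (.imp (.atom 0) (.imp
    (.imp (.atom 1) (.iff (.atom 2) (.atom 0))) (.imp (.imp (.atom 1) (.iff (.atom 2) (.atom 3)))
    (.imp (.atom 1) (.atom 3))))) ![tru, dfd A, _, _] (by decide))))

omit hH in
theorem proves_strict {α β : Ty} (hα : α ≠ o) (F : Wff C (fn α β)) (D : Wff C β) :
    Proves H (imp (or (not (dfd F)) (not (dfd D))) (not (dfd (app F D)))) :=
  (Schema.A10 hα F D (freshOf _ _ _ le_rfl) (freshOf _ _ _ le_rfl)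
    (freshOf _ _ _ le_rfl)).proves

omit hH in
theorem proves_strict_o {β : Ty} (F : Wff C (fn o β)) (D : Wff C β) :
    Proves H (imp (or (not (dfd F)) (not (dfd D))) (not (app F D))) :=
  (Schema.A9 F D (freshOf _ _ _ le_rfl) (freshOf _ _ _ le_rfl)).proves

/-- An equation is an application of `Q`, and applications to undefined arguments are false or
undefined. -/
theorem proves_eq_strict {α : Ty} (A B : Wff C α) :
    Proves H (imp (eq A B) (and (dfd A) (dfd B))) :=
  (proves_strict_o (app (Q α) A) B).R2 ((proves_strict (by simp) (Q α) A).R2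
    (taut (.imp (.imp (.or (.not (.atom 0)) (.not (.atom 1))) (.not (.atom 2)))
      (.imp (.imp (.or (.not (.atom 2)) (.not (.atom 3))) (.not (.atom 4)))
      (.imp (.atom 4) (.and (.atom 1) (.atom 3)))))
      ![dfd (Q α), dfd A, dfd (app (Q α) A), dfd B, eq A B] (by decide)))

/-- Leibniz' law. -/
theorem proves_leibniz {α : Ty} (X Y : Wff C α) {G : Wff C (fn o α)} (hG : Df H G) :
    Proves H (imp (eq X Y) (eq (app G X) (app G Y))) := by
  obtain ⟨p, hp⟩ : ∃ p, p = max G.bd (max X.bd Y.bd) := ⟨_, rfl⟩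
  have hG1 : ¬ G.Free α p := not_free_of_bd_le (by omega)
  have hG2 : ¬ G.Free α (p + 1) := not_free_of_bd_le (by omega)
  have hX2 : ¬ X.Free α (p + 1) := not_free_of_bd_le (by omega)
  have hX3 : ¬ (dfd X).Free α (p + 1) := by simp [dfd, hX2]
  have h1 := proves_leibniz_of_df (H := H) (X := var α p) (Y := var α (p + 1)) df_var df_var hG
  have h2 := h1.imp_subst (n := p) (A := X) (by simp [freeFor_of_not_free hG1])
  rw [subst_imp, subst_eq, subst_eq, subst_app, subst_app, subst_var,
    subst_var_ne (by simp), subst_of_not_free hG1] at h2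
  have h3 := h2.imp_subst (n := p + 1) (A := Y)
    (by simp [freeFor_of_not_free hG2, freeFor_of_not_free hX2, freeFor_of_not_free hX3])
  rw [subst_imp, subst_imp, subst_eq, subst_eq, subst_app, subst_app, subst_var,
    subst_of_not_free hG2, subst_of_not_free hX2, subst_of_not_free hX3] at h3
  exact h3.R2 ((proves_eq_strict X Y).R2 (taut (.imp (.imp (.atom 0) (.and (.atom 1) (.atom 2)))
    (.imp (.imp (.atom 2) (.imp (.atom 1) (.imp (.atom 0) (.atom 3)))) (.imp (.atom 0) (.atom 3))))
    ![_, dfd X, dfd Y, _] (by decide)))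

set_option maxRecDepth 4000 in
theorem proves_leibniz_subst {α : Ty} {n : ℕ} {X Y : Wff C α} {B : Wff C o}
    (hX : FreeFor α n X B) (hY : FreeFor α n Y B) :
    Proves H (imp (eq X Y) (eq (subst α n X B) (subst α n Y B))) :=
  (proves_imp_dfd_beta hY).R2 ((proves_imp_dfd_beta hX).R2 ((proves_eq_strict X Y).R2
    ((proves_leibniz X Y (G := lam α n B) df_lam).R2 (taut (.imp (.imp (.atom 0)
      (.iff (.atom 1) (.atom 2))) (.imp (.imp (.atom 0) (.and (.atom 3) (.atom 4)))
      (.imp (.imp (.atom 3) (.iff (.atom 1) (.atom 5))) (.imp (.imp (.atom 4)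
      (.iff (.atom 2) (.atom 6))) (.imp (.atom 0) (.iff (.atom 5) (.atom 6)))))))
      ![_, _, _, dfd X, dfd Y, _, _] (by decide)))))

/-- Leibniz' law for the formula `F D ≃ f D` in the variable `f`, which holds at `F` by reflexivity.
The number `k` serves both for `f` and for bound variables; their types `αβ` and `α` differ. -/
theorem proves_eq_imp_qe_appLeft {α β : Ty} (F F' : Wff C (fn α β)) (D : Wff C β) :
    Proves H (imp (eq F F') (qe (app F D) (app F' D))) := by
  obtain ⟨k, hk⟩ : ∃ k, k = max F.bd (max F'.bd D.bd) := ⟨_, rfl⟩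
  have hF : ¬ F.Free α k := not_free_of_bd_le (by omega)
  have hF' : ¬ F'.Free α k := not_free_of_bd_le (by omega)
  have hFk : ¬ F.Free (fn α β) k := not_free_of_bd_le (by omega)
  have hDk : ¬ D.Free (fn α β) k := not_free_of_bd_le (by omega)
  have e := fn_ne_left α β
  have hs (X : Wff C (fn α β)) : subst (fn α β) k X (qn k k (app F D) (app (var _ k) D)) =
      qn k k (app F D) (app X D) := by
    rw [subst_qn _ _ (by simp [e.symm]) (by simp [e.symm])]
    simp [subst_of_not_free hFk, subst_of_not_free hDk]
  have hf (X : Wff C (fn α β)) (hX : ¬ X.Free α k) :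
      FreeFor (fn α β) k X (qn k k (app F D) (app (var _ k) D)) :=
    freeFor_qn hX hX (by simp [freeFor_of_not_free hFk, freeFor_of_not_free hDk])
      (by simp [freeFor_of_not_free hDk])
  have h1 := proves_leibniz_subst (H := H) (hf F hF) (hf F' hF')
  rw [hs, hs] at h1
  have h2 := ((Rw.refl _).imp ((rw_qn_qe (by simp [bd]; omega) (by simp [bd]; omega)).eq
    (rw_qn_qe (by simp [bd]; omega) (by simp [bd]; omega)))).mp h1
  exact h2.R2 ((Rw.refl (app F D)).qe.R2 (taut (.imp (.atom 0) (.imp (.imp (.atom 1)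
    (.iff (.atom 0) (.atom 2))) (.imp (.atom 1) (.atom 2)))) ![_, _, _] (by decide)))

theorem proves_eq_imp_qe_appRight {α β : Ty} (F : Wff C (fn α β)) (D D' : Wff C β) :
    Proves H (imp (eq D D') (qe (app F D) (app F D'))) := by
  obtain ⟨k, hk⟩ : ∃ k, k = max F.bd (max D.bd D'.bd) := ⟨_, rfl⟩
  have hD : ¬ D.Free α (k + 1) := not_free_of_bd_le (by omega)
  have hD' : ¬ D'.Free α (k + 1) := not_free_of_bd_le (by omega)
  have hFk : ¬ F.Free β k := not_free_of_bd_le (by omega)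
  have hDk : ¬ D.Free β k := not_free_of_bd_le (by omega)
  -- Here `β` may equal `α`, so the bound variables need a number other than `k`.
  have hs (X : Wff C β) : subst β k X (qn (k + 1) (k + 1) (app F D) (app F (var _ k))) =
      qn (k + 1) (k + 1) (app F D) (app F X) := by
    rw [subst_qn _ _ (by simp) (by simp)]
    simp [subst_of_not_free hFk, subst_of_not_free hDk]
  have hf (X : Wff C β) (hX : ¬ X.Free α (k + 1)) :
      FreeFor β k X (qn (k + 1) (k + 1) (app F D) (app F (var _ k))) :=
    freeFor_qn hX hX (by simp [freeFor_of_not_free hFk, freeFor_of_not_free hDk])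
      (by simp [freeFor_of_not_free hFk])
  have h1 := proves_leibniz_subst (H := H) (hf D hD) (hf D' hD')
  rw [hs, hs] at h1
  have h2 := ((Rw.refl _).imp ((rw_qn_qe (by simp [bd]; omega) (by simp [bd]; omega)).eq
    (rw_qn_qe (by simp [bd]; omega) (by simp [bd]; omega)))).mp h1
  exact h2.R2 ((Rw.refl (app F D)).qe.R2 (taut (.imp (.atom 0) (.imp (.imp (.atom 1)
    (.iff (.atom 0) (.atom 2))) (.imp (.atom 1) (.atom 2)))) ![_, _, _] (by decide)))

/-! ### The deduction theorem -/

omit hH in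
theorem rw_qe_o (A B : Wff C o) : Rw H (qe A B) (eq A B) :=
  rw_qn_eq df_o df_o (not_occurs_of_bd_le le_rfl) (not_occurs_of_bd_le le_rfl)

set_option maxRecDepth 4000 in
-- If `F` or `F'` is defined, the hypothesis is a genuine equation. Otherwise strictness makes both
-- applications undefined, or both false when their type is `o`.
theorem proves_qe_appLeft {α β : Ty} (F F' : Wff C (fn α β)) (D : Wff C β) :
    Proves H (imp (qe F F') (qe (app F D) (app F' D))) := by
  have h1 := proves_eq_imp_qe_appLeft (H := H) F F' D
  by_cases hα : α = o
  · subst hα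
    refine ((Rw.refl _).imp (rw_qe_o _ _)).symm.mp ?_
    exact (proves_strict_o F' D).R2 ((proves_strict_o F D).R2
      ((((Rw.refl _).imp (rw_qe_o _ _)).mp h1).R2 (taut (.imp (.imp (.atom 0) (.iff (.atom 1)
      (.atom 2))) (.imp (.imp (.or (.not (.atom 3)) (.not (.atom 4))) (.not (.atom 1)))
      (.imp (.imp (.or (.not (.atom 5)) (.not (.atom 4))) (.not (.atom 2)))
      (.imp (.imp (.or (.atom 3) (.atom 5)) (.atom 0)) (.iff (.atom 1) (.atom 2))))))
      ![_, _, _, dfd F, dfd D, dfd F'] (by decide))))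
  · exact (proves_strict hα F' D).R2 ((proves_strict hα F D).R2
      (h1.R2 (taut (.imp (.imp (.atom 0) (.imp (.or (.atom 1)
      (.atom 2)) (.atom 6))) (.imp (.imp (.or (.not (.atom 3)) (.not (.atom 4))) (.not (.atom 1)))
      (.imp (.imp (.or (.not (.atom 5)) (.not (.atom 4))) (.not (.atom 2)))
      (.imp (.imp (.or (.atom 3) (.atom 5)) (.atom 0)) (.imp (.or (.atom 1) (.atom 2)) (.atom 6))))))
      ![_, _, _, dfd F, dfd D, dfd F', _] (by decide))))

set_option maxRecDepth 4000 in
theorem proves_qe_appRight {α β : Ty} (F : Wff C (fn α β)) (D D' : Wff C β) :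
    Proves H (imp (qe D D') (qe (app F D) (app F D'))) := by
  have h1 := proves_eq_imp_qe_appRight (H := H) F D D'
  by_cases hα : α = o
  · subst hα
    refine ((Rw.refl _).imp (rw_qe_o _ _)).symm.mp ?_
    exact (proves_strict_o F D').R2 ((proves_strict_o F D).R2
      ((((Rw.refl _).imp (rw_qe_o _ _)).mp h1).R2 (taut (.imp (.imp (.atom 0) (.iff (.atom 1)
      (.atom 2))) (.imp (.imp (.or (.not (.atom 4)) (.not (.atom 3))) (.not (.atom 1)))
      (.imp (.imp (.or (.not (.atom 4)) (.not (.atom 5))) (.not (.atom 2)))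
      (.imp (.imp (.or (.atom 3) (.atom 5)) (.atom 0)) (.iff (.atom 1) (.atom 2))))))
      ![_, _, _, dfd D, dfd F, dfd D'] (by decide))))
  · exact (proves_strict hα F D').R2 ((proves_strict hα F D).R2
      (h1.R2 (taut (.imp (.imp (.atom 0) (.imp (.or (.atom 1)
      (.atom 2)) (.atom 6))) (.imp (.imp (.or (.not (.atom 4)) (.not (.atom 3))) (.not (.atom 1)))
      (.imp (.imp (.or (.not (.atom 4)) (.not (.atom 5))) (.not (.atom 2)))
      (.imp (.imp (.or (.atom 3) (.atom 5)) (.atom 0)) (.imp (.or (.atom 1) (.atom 2)) (.atom 6))))))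
      ![_, _, _, dfd D, dfd F, dfd D', _] (by decide))))

theorem Proves.imp_trans {A B D : Wff C o} (h : Proves H (imp A B)) (h' : Proves H (imp B D)) :
    Proves H (imp A D) :=
  h'.R2 (h.R2 (taut (.imp (.imp (.atom 0) (.atom 1)) (.imp (.imp (.atom 1) (.atom 2))
    (.imp (.atom 0) (.atom 2)))) ![_, _, _] (by decide)))

/-- `∀x [A ⊃ B] ⊃ [A ⊃ ∀x B]` is proved by cases on the truth value of `A`, after putting a variable
in its place. -/
theorem Proves.imp_all {A B : Wff C o} {β : Ty} {n : ℕ} (h : Proves H (imp A B))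
    (hA : ¬ A.Free β n) : Proves H (imp A (all β n B)) := by
  obtain ⟨p, hp⟩ : ∃ p, p = max (n + 1) B.bd := ⟨_, rfl⟩
  have hB : ¬ B.Free o p := not_free_of_bd_le (by omega)
  have hne : ¬ (β = o ∧ n = p) := by omega
  have hs (X : Wff C o) : Wff.subst o p X (imp (all β n (imp (var o p) B)) (imp (var o p) (all β n B)))
      = imp (all β n (imp X B)) (imp X (all β n B)) := by
    rw [subst_imp, subst_imp, subst_all _ hne, subst_all _ hne, subst_imp, subst_var,
      subst_of_not_free hB]
  have hf (X : Wff C o) (hX : ¬ X.Free β n) :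
      FreeFor o p X (imp (all β n (imp (var o p) B)) (imp (var o p) (all β n B))) := by
    simp only [freeFor_imp, freeFor_var, true_and]
    exact ⟨freeFor_all hX (by simp [freeFor_of_not_free hB]),
      freeFor_all hX (freeFor_of_not_free hB)⟩
  have h1 := Proves.cases (H := H) (hf tru (by simp)) (hf fls (by simp))
    (by
      rw [hs]
      refine (((rw_tru_imp B).all β n).imp (rw_tru_imp _)).symm.mp ?_
      exact taut (.imp (.atom 0) (.atom 0)) ![_] (by decide))
    (by
      rw [hs]
      exact ((Rw.refl _).imp (rw_fls_imp _)).symm.mp ((rw_imp_tru _).symm.mp proves_tru))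
    (hf A hA)
  rw [hs] at h1
  exact (h.gen β n).R2 h1

theorem rw_eq_lam {α β : Ty} {n : ℕ} (D D' : Wff C α) :
    Rw H (eq (lam β n D) (lam β n D')) (all β n (qe D D')) := by
  obtain ⟨k, hk⟩ : ∃ k, k = max (n + 4) (max D.bd D'.bd) := ⟨_, rfl⟩
  have h1 := rw_ext (H := H) (v := n) (k := k) (F := lam β n D) (G := lam β n D') df_lam df_lam
    (by simp) (by simp) (by omega) (by omega) (not_free_of_bd_le (by simp [bd]; omega))
    (not_free_of_bd_le (by simp [bd]; omega))
  exact h1.trans ((((rw_beta_self _).qn k k (rw_beta_self _)).trans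
    (rw_qn_qe (by omega) (by omega))).all _ _)

/-- The effect of R1 under an assumption `A`, by induction on the position of the replaced
occurrence. At a `λ` one generalizes and uses extensionality, which is legitimate because `A` is
closed. -/
theorem Replace.proves_imp_qe {P : Ty → ℕ → Prop} {A : Wff C o} (hA : A.Closed) {α : Ty}
    {X Y : Wff C α} (h : Proves H (imp A (qe X Y)))
    {γ : Ty} {D E : Wff C γ} (r : Replace P X Y D E) : Proves H (imp A (qe D E)) := by
  induction r with
  | here => exact h
  | appLeft D _ ih => exact ih.imp_trans (proves_qe_appLeft _ _ _)
  | appRight F _ ih => exact ih.imp_trans (proves_qe_appRight _ _ _)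
  | @lam β n γ D D' _ _ ih =>
    exact (((Rw.refl A).imp (rw_eq_lam D D').symm).mp (ih.imp_all (hA β n))).R2
      (taut (.imp (.imp (.atom 0) (.atom 1)) (.imp (.atom 0) (.imp (.or (.atom 2) (.atom 3))
        (.atom 1)))) ![A, _, dfd (Wff.lam β n D), dfd (Wff.lam β n D')] (by decide))

omit hH in
theorem AreSentences.insert {A : Wff C o} (hA : A.Closed) (h : AreSentences H) :
    AreSentences (insert A H) := by
  rintro B (rfl | hB)
  · exact hA
  · exact h B hB

/-- The deduction theorem. -/
theorem Proves.deduction {A B : Wff C o} (hA : A.Closed) (h : Proves (insert A H) B) :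
    Proves H (imp A B) := by
  have weaken {D : Wff C o} (hD : Proves H D) : Proves H (imp A D) :=
    hD.R2 (taut (.imp (.atom 0) (.imp (.atom 1) (.atom 0))) ![D, A] (by decide))
  induction h with
  | @hyp D hD =>
    rcases hD with rfl | hD
    · exact taut (.imp (.atom 0) (.atom 0)) ![_] (by decide)
    · exact weaken (.hyp hD)
  | thm hD => exact weaken (.thm hD)
  | @R1 α X Y k l D E _ _ r ih1 ih2 =>
    have h1 := r.proves_imp_qe hA (((Rw.refl A).imp (rw_qe k l)).mp ih1)
    have h2 := ((Rw.refl A).imp (rw_qe_o D E)).mp h1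
    exact ih2.R2 (h2.R2 (taut (.imp (.imp (.atom 0) (.iff (.atom 1) (.atom 2)))
      (.imp (.imp (.atom 0) (.atom 1)) (.imp (.atom 0) (.atom 2)))) ![A, D, E] (by decide)))
  | @R2 D E _ _ ih1 ih2 =>
    exact ih1.R2 (ih2.R2 (taut (.imp (.imp (.atom 0) (.imp (.atom 1) (.atom 2)))
      (.imp (.imp (.atom 0) (.atom 1)) (.imp (.atom 0) (.atom 2)))) ![A, D, E] (by decide)))

end Wff

end Q0u

namespace Q0u

open Ty

namespace Wff

variable {C C' : Ty → Type u}

/-! ### Replacing constants by constants or variables -/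

/-- The image of a primitive constant under an assignment of wffs to the nonlogical constants. -/
def trConst (f : ∀ α, C α → Wff C' α) : {α : Ty} → PrimConst C α → Wff C' α
  | _, .Q α => const (.Q α)
  | _, .iota α h => const (.iota α h)
  | _, .nonlog c => f _ c

/-- The result of replacing each nonlogical constant `c` by `f c`. -/
def tr (f : ∀ α, C α → Wff C' α) : {α : Ty} → Wff C α → Wff C' α
  | _, var α n => var α n
  | _, const c => trConst f c
  | _, app F A => app (F.tr f) (A.tr f)
  | _, lam β n A => lam β n (A.tr f)

/-- Each nonlogical constant is assigned a constant, or a variable with a number at least `N`. -/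
def ConstOrVar (f : ∀ α, C α → Wff C' α) (N : ℕ) : Prop :=
  ∀ α c, (∃ c', f α c = const c') ∨ ∃ m, N ≤ m ∧ f α c = var α m

variable {f : ∀ α, C α → Wff C' α} {N : ℕ}

theorem ConstOrVar.mono {M : ℕ} (hf : ConstOrVar f N) (h : M ≤ N) : ConstOrVar f M :=
  fun α c => (hf α c).imp id fun ⟨m, hm, e⟩ => ⟨m, h.trans hm, e⟩

theorem ConstOrVar.trConst (hf : ConstOrVar f N) :
    ∀ {α : Ty} (c : PrimConst C α),
      (∃ c', trConst f c = const c') ∨ ∃ m, N ≤ m ∧ Wff.trConst f c = var α m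
  | _, .Q α => Or.inl ⟨.Q α, rfl⟩
  | _, .iota α h => Or.inl ⟨.iota α h, rfl⟩
  | _, .nonlog c => hf _ c

theorem ConstOrVar.occurs (hf : ConstOrVar f N) {β : Ty} {n : ℕ} (hn : n < N) :
    ∀ {α : Ty} {A : Wff C α}, (A.tr f).Occurs β n → A.Occurs β n
  | _, var _ _, h => h
  | _, const c, h => by
      rcases hf.trConst c with ⟨c', e⟩ | ⟨m, hm, e⟩
      · rw [tr, e] at h; exact h
      · rw [tr, e] at h; exact absurd h.2 (by omega)
  | _, app _ _, h => h.imp (hf.occurs hn) (hf.occurs hn)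
  | _, lam _ _ _, h => h.imp id (hf.occurs hn)

theorem ConstOrVar.free (hf : ConstOrVar f N) {β : Ty} {n : ℕ} (hn : n < N) :
    ∀ {α : Ty} {A : Wff C α}, (A.tr f).Free β n → A.Free β n
  | _, var _ _, h => h
  | _, const c, h => by
      rcases hf.trConst c with ⟨c', e⟩ | ⟨m, hm, e⟩
      · rw [tr, e] at h; exact h
      · rw [tr, e] at h; exact absurd h.2 (by omega)
  | _, app _ _, h => h.imp (hf.free hn) (hf.free hn)
  | _, lam _ _ _, h => h.imp id (hf.free hn)

theorem ConstOrVar.freeFor (hf : ConstOrVar f N) {β : Ty} {n : ℕ} (hn : n < N) {A : Wff C β} :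
    ∀ {α : Ty} {B : Wff C α}, B.bd ≤ N → FreeFor β n A B → FreeFor β n (A.tr f) (B.tr f)
  | _, var _ _, _, _ => trivial
  | _, const c, _, _ => by
      rcases hf.trConst c with ⟨c', e⟩ | ⟨m, hm, e⟩ <;> · rw [tr, e]; trivial
  | _, app _ _, hB, h => by
      simp only [bd, max_le_iff] at hB
      exact ⟨hf.freeFor hn hB.1 h.1, hf.freeFor hn hB.2 h.2⟩
  | _, lam _ _ _, hB, h => by
      simp only [bd, max_le_iff] at hB
      intro h'
      have h2 := h (hf.free hn (A := lam _ _ _) h')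
      exact ⟨fun h3 => h2.1 (hf.free hB.1 h3), hf.freeFor hn hB.2 h2.2⟩

theorem ConstOrVar.tr_subst (hf : ConstOrVar f N) {β : Ty} {n : ℕ} (hn : n < N) {A : Wff C β} :
    ∀ {α : Ty} (B : Wff C α), (subst β n A B).tr f = subst β n (A.tr f) (B.tr f)
  | _, var γ m => by
      by_cases h : β = γ ∧ m = n
      · obtain ⟨rfl, rfl⟩ := h; simp [tr]
      · rw [subst_var_ne h, tr, subst_var_ne h]
  | _, const c => by
      rcases hf.trConst c with ⟨c', e⟩ | ⟨m, hm, e⟩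
      · rw [subst_const, tr, e, subst_const]
      · rw [subst_const, tr, e, subst_var_ne (by omega)]
  | _, app F B => by simp [tr, hf.tr_subst hn]
  | _, lam γ m B => by
      by_cases h : γ = β ∧ m = n
      · simp [subst, h, tr]
      · simp [subst, h, tr, hf.tr_subst hn]

/-- A fresh variable stays fresh if its number is small. -/
def ConstOrVar.fresh (hf : ConstOrVar f N) {α β : Ty} {A : Wff C α} (k : Fresh β A)
    (hk : k.1 < N) : Fresh β (A.tr f) := ⟨k.1, fun h => k.2 (hf.occurs hk h)⟩

theorem bd_app_le {α β : Ty} {F : Wff C (fn α β)} {A : Wff C β} :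
    (app F A).bd ≤ N ↔ F.bd ≤ N ∧ A.bd ≤ N := max_le_iff

theorem bd_lam_le {α β : Ty} {n : ℕ} {A : Wff C α} :
    (lam β n A).bd ≤ N ↔ n < N ∧ A.bd ≤ N := max_le_iff

theorem bd_eq_le {α : Ty} {A B : Wff C α} : (eq A B).bd ≤ N ↔ A.bd ≤ N ∧ B.bd ≤ N := by
  simp [eq, Q, bd]

theorem bd_ex_le {α : Ty} {n : ℕ} {A : Wff C o} (h : (ex α n A).bd ≤ N) :
    n < N ∧ A.bd ≤ N := by
  simp only [ex, not, all, bd_app_le, bd_eq_le, bd_lam_le] at h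
  exact ⟨h.2.2.1, h.2.2.2.2⟩

theorem bd_defd_le {α : Ty} {A : Wff C α} {k} (h : (defd A k).bd ≤ N) : k.1 < N ∧ A.bd ≤ N := by
  have := bd_ex_le h; rw [bd_eq_le] at this; exact ⟨this.1, this.2.2⟩

theorem bd_undefd_le {α : Ty} {A : Wff C α} {k} (h : (undefd A k).bd ≤ N) :
    k.1 < N ∧ A.bd ≤ N := bd_defd_le (bd_app_le.1 h).2

theorem bd_imp_le {A B : Wff C o} (h : (imp A B).bd ≤ N) : A.bd ≤ N ∧ B.bd ≤ N := by
  simp only [imp, bd_app_le] at h; exact ⟨h.1.2, h.2⟩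

theorem bd_or_le {A B : Wff C o} (h : (or A B).bd ≤ N) : A.bd ≤ N ∧ B.bd ≤ N := by
  simp only [or, bd_app_le] at h; exact ⟨h.1.2, h.2⟩

theorem bd_and_le {A B : Wff C o} (h : (and A B).bd ≤ N) : A.bd ≤ N ∧ B.bd ≤ N := by
  simp only [and, bd_app_le] at h; exact ⟨h.1.2, h.2⟩

theorem bd_qeq_le {α : Ty} {A B : Wff C α} {k l} (h : (qeq A B k l).bd ≤ N) :
    k.1 < N ∧ l.1 < N ∧ A.bd ≤ N ∧ B.bd ≤ N := by
  have h1 := bd_or_le (bd_imp_le h).1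
  have h2 := bd_defd_le h1.1
  have h3 := bd_defd_le h1.2
  exact ⟨h2.1, h3.1, h2.2, h3.2⟩

theorem bd_exUnique_le {α : Ty} {n : ℕ} {A : Wff C o} {k} (h : (exUnique α n A k).bd ≤ N) :
    k.1 < N ∧ n < N ∧ A.bd ≤ N := by
  have := bd_ex_le h
  rw [bd_eq_le, bd_lam_le] at this
  exact ⟨this.1, this.2.1⟩

/-! ### Translating axioms and proofs -/

/-- Variables numbered at least `N` are neither bound nor substituted for in the axiom, so all side
conditions on variables survive. -/
theorem Schema.tr (hf : ConstOrVar f N) {A : Wff C o} (h : Schema A) (hA : A.bd ≤ N) :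
    Schema (A.tr f) := by
  cases h with
  | A1 => exact Schema.A1
  | A2 α => exact Schema.A2 α
  | A3 α β k l => exact Schema.A3 (C := C') α β ⟨k.1, k.2⟩ ⟨l.1, l.2⟩
  | @A4 α β n A B h j k l =>
    have h1 := bd_imp_le hA
    have h2 := bd_qeq_le h1.2
    rw [bd_app_le, bd_lam_le] at h2
    have h3 := hf.freeFor h2.2.2.1.1.1 h2.2.2.1.1.2 h
    have e := hf.tr_subst h2.2.2.1.1.1 (A := A) B
    have := Schema.A4 n (A.tr f) (B.tr f) h3 (hf.fresh j (bd_defd_le h1.1).1) (hf.fresh k h2.1)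
      ⟨l.1, e ▸ (hf.fresh l h2.2.1).2⟩
    change Schema (imp (dn j.1 (A.tr f)) (qn k.1 l.1 (app (Wff.lam α n (B.tr f)) (A.tr f)) _)) at this
    rw [← e] at this
    exact this
  | A5 α n k => exact Schema.A5 (C := C') α n ⟨k.1, k.2⟩
  | A6 c k =>
    have hk := (bd_defd_le hA).1
    change Schema (dn k.1 (trConst f c))
    rcases hf.trConst c with ⟨c', e⟩ | ⟨m, hm, e⟩
    · rw [e]; exact Schema.A6 c' ⟨k.1, id⟩
    -- A constant that has become a variable turns an instance of A6 into one of A5.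
    · rw [e]; exact Schema.A5 _ m ⟨k.1, fun h => by have := h.2; omega⟩
  | A7 α n B k => exact Schema.A7 α n (B.tr f) (hf.fresh k (bd_defd_le hA).1)
  | A8 A B k => exact Schema.A8 (A.tr f) (B.tr f) (hf.fresh k (bd_defd_le hA).1)
  | A9 A B k l =>
    have h1 := bd_or_le (bd_imp_le hA).1
    exact Schema.A9 (A.tr f) (B.tr f) (hf.fresh k (bd_undefd_le h1.1).1)
      (hf.fresh l (bd_undefd_le h1.2).1)
  | A10 hα A B j k l =>
    have h1 := bd_or_le (bd_imp_le hA).1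
    exact Schema.A10 hα (A.tr f) (B.tr f) (hf.fresh j (bd_undefd_le h1.1).1)
      (hf.fresh k (bd_undefd_le h1.2).1) (hf.fresh l (bd_undefd_le (bd_imp_le hA).2).1)
  | A11 A B i j k l p q =>
    have h1 := bd_imp_le hA
    have h2 := bd_imp_le h1.2
    have h3 := bd_qeq_le h2.2
    have h4 := bd_qeq_le h3.2.2.1
    exact Schema.A11 (A.tr f) (B.tr f) (hf.fresh i (bd_defd_le h1.1).1)
      (hf.fresh j (bd_defd_le h2.1).1) (hf.fresh k h4.1) (hf.fresh l h4.2.1)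
      (hf.fresh p h3.1) (hf.fresh q h3.2.1)
  | @A12 α hα n A h k l =>
    have h1 := bd_imp_le hA
    have h2 := bd_exUnique_le h1.1
    have h3 := bd_defd_le (bd_and_le h1.2).1
    have := Schema.A12 hα n (A.tr f) (hf.freeFor h2.2.1 h2.2.2 h) (hf.fresh k h2.1)
      (hf.fresh l h3.1)
    have e := hf.tr_subst h2.2.1 (A := desc α hα n A) A
    change Schema (imp _ (and _ ((subst α n (desc α hα n A) A).tr f)))
    rw [e]
    exact this
  | A13 hα n A k l =>
    have h1 := bd_imp_le hA
    exact Schema.A13 hα n (A.tr f) (hf.fresh k (bd_exUnique_le (bd_app_le.1 h1.1).2).1)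
      (hf.fresh l (bd_undefd_le h1.2).1)

theorem Rep.tr {α : Ty} {A B : Wff C α} :
    ∀ {γ : Ty} {D E : Wff C γ}, Rep A B D E → Rep (A.tr f) (B.tr f) (D.tr f) (E.tr f)
  | _, _, _, .here => .here
  | _, _, _, .appLeft D r => .appLeft _ (Rep.tr r)
  | _, _, _, .appRight F r => .appRight _ (Rep.tr r)
  | _, _, _, .lam β n hn r => .lam β n hn (Rep.tr r)

theorem Thm.tr {A : Wff C o} (h : Thm A) :
    ∃ N, ∀ f : ∀ α, C α → Wff C' α, ConstOrVar f N → Thm (A.tr f) := by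
  induction h with
  | @schema A h => exact ⟨A.bd, fun f hf => .schema (h.tr hf le_rfl)⟩
  | @R1 α A B k l D E _ _ r ih1 ih2 =>
    obtain ⟨N, ih1⟩ := ih1
    obtain ⟨M, ih2⟩ := ih2
    refine ⟨max (qeq A B k l).bd (max N M), fun f hf => ?_⟩
    have hk := bd_qeq_le (le_max_left (qeq A B k l).bd (max N M))
    exact .R1 (k := hf.fresh k hk.1) (l := hf.fresh l hk.2.1)
      (ih1 f (hf.mono (by omega))) (ih2 f (hf.mono (by omega))) (Rep.tr r)
  | R2 _ _ ih1 ih2 =>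
    obtain ⟨N, ih1⟩ := ih1
    obtain ⟨M, ih2⟩ := ih2
    exact ⟨max N M, fun f hf => .R2 (ih1 f (hf.mono (by omega))) (ih2 f (hf.mono (by omega)))⟩

/-- A proof involves only finitely many wffs, so a single `N` serves for all its steps. It is chosen
before `f`, which lets the substituted variable avoid the whole proof. -/
theorem Proves.tr {H : Set (Wff C o)} {H' : Set (Wff C' o)} [hH' : Fact (AreSentences H')]
    {A : Wff C o} (h : Proves H A) :
    ∃ N, ∀ f : ∀ α, C α → Wff C' α, ConstOrVar f N → (∀ B ∈ H, Proves H' (B.tr f)) →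
      Proves H' (A.tr f) := by
  induction h with
  | hyp h => exact ⟨0, fun f _ hfH => hfH _ h⟩
  | thm h =>
    obtain ⟨N, h⟩ := h.tr (C' := C')
    exact ⟨N, fun f hf _ => .thm (h f hf)⟩
  | @R1 α A B k l D E _ _ r ih1 ih2 =>
    obtain ⟨N, ih1⟩ := ih1
    obtain ⟨M, ih2⟩ := ih2
    refine ⟨max (qeq A B k l).bd (max N M), fun f hf hfH => ?_⟩
    have hk := bd_qeq_le (le_max_left (qeq A B k l).bd (max N M))
    exact Proves.rep (k := hf.fresh k hk.1) (l := hf.fresh l hk.2.1)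
      (ih1 f (hf.mono (by omega)) hfH) (ih2 f (hf.mono (by omega)) hfH)
      (Rep.tr (r.mono fun _ _ => False.elim))
  | R2 _ _ ih1 ih2 =>
    obtain ⟨N, ih1⟩ := ih1
    obtain ⟨M, ih2⟩ := ih2
    exact ⟨max N M, fun f hf hfH => .R2 (ih1 f (hf.mono (by omega)) hfH)
      (ih2 f (hf.mono (by omega)) hfH)⟩

/-! ### Monotonicity and finiteness -/

theorem Proves.mono {H H' : Set (Wff C o)} [Fact (AreSentences H')] (hs : H ⊆ H') {A : Wff C o}
    (h : Proves H A) : Proves H' A := by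
  induction h with
  | hyp h => exact .hyp (hs h)
  | thm h => exact .thm h
  | R1 _ _ r ih1 ih2 => exact ih1.rep ih2 (r.mono fun _ _ => False.elim)
  | R2 _ _ ih1 ih2 => exact ih1.R2 ih2

theorem Proves.exists_finite {H : Set (Wff C o)} (hH : AreSentences H) {A : Wff C o}
    (h : Proves H A) : ∃ S ⊆ H, S.Finite ∧ Proves S A := by
  induction h with
  | @hyp A h => exact ⟨{A}, by simpa using h, Set.finite_singleton A, .hyp rfl⟩
  | thm h => exact ⟨∅, Set.empty_subset _, Set.finite_empty, .thm h⟩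
  | R1 _ _ r ih1 ih2 =>
    obtain ⟨S, hS, hSf, h1⟩ := ih1
    obtain ⟨T, hT, hTf, h2⟩ := ih2
    have : Fact (AreSentences (S ∪ T)) := ⟨fun B hB => hH B (Set.union_subset hS hT hB)⟩
    exact ⟨S ∪ T, Set.union_subset hS hT, hSf.union hTf, (h1.mono Set.subset_union_left).rep
      (h2.mono Set.subset_union_right) (r.mono fun _ _ => False.elim)⟩
  | R2 _ _ ih1 ih2 =>
    obtain ⟨S, hS, hSf, h1⟩ := ih1
    obtain ⟨T, hT, hTf, h2⟩ := ih2
    have : Fact (AreSentences (S ∪ T)) := ⟨fun B hB => hH B (Set.union_subset hS hT hB)⟩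
    exact ⟨S ∪ T, Set.union_subset hS hT, hSf.union hTf, (h1.mono Set.subset_union_left).R2
      (h2.mono Set.subset_union_right)⟩

end Wff

end Q0u

namespace Q0u

open Ty Cardinal

/-! ### The number of wffs -/

/-- A code for a type symbol. -/
def Ty.code : Ty → ℕ
  | ind => 0
  | o => 1
  | fn α β => Nat.pair α.code β.code + 2

theorem Ty.code_injective : Function.Injective Ty.code
  | ind, b, h => by cases b <;> simp [Ty.code] at h ⊢
  | o, b, h => by cases b <;> simp [Ty.code] at h ⊢
  | fn α β, b, h => by
      cases b with
      | fn γ δ =>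
        simp only [Ty.code, Nat.add_right_cancel_iff, Nat.pair_eq_pair] at h
        rw [Ty.code_injective h.1, Ty.code_injective h.2]
      | _ => simp [Ty.code] at h

instance : Countable Ty := Ty.code_injective.countable

variable {C : Ty → Type u}

/-- The symbols of the tree of a wff. -/
inductive Sym (C : Ty → Type u) : Type u
  | var (α : Ty) (n : ℕ)
  | Q (α : Ty)
  | iota (α : Ty)
  | nonlog (c : Σ α, C α)
  | app (α β : Ty)
  | lam (α β : Ty) (n : ℕ)

/-- The number of subtrees at a symbol. -/
def Sym.arity : Sym C → Type
  | app _ _ => Bool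
  | lam _ _ _ => Unit
  | _ => Empty

instance : ∀ s : Sym C, Finite s.arity
  | .app _ _ => inferInstanceAs (Finite Bool)
  | .lam _ _ _ => inferInstanceAs (Finite Unit)
  | .var _ _ | .Q _ | .iota _ | .nonlog _ => inferInstanceAs (Finite Empty)

/-- The tree of a primitive constant. -/
def PrimConst.tree : {α : Ty} → PrimConst C α → WType (Sym.arity (C := C))
  | _, Q α => .mk (.Q α) Empty.elim
  | _, iota α _ => .mk (.iota α) Empty.elim
  | _, nonlog c => .mk (.nonlog ⟨_, c⟩) Empty.elim

/-- The tree of a wff. -/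
def Wff.tree : {α : Ty} → Wff C α → WType (Sym.arity (C := C))
  | _, var α n => .mk (.var α n) Empty.elim
  | _, const c => c.tree
  | _, app (α := α) (β := β) F A => .mk (.app α β) fun b => bif b then F.tree else A.tree
  | _, lam β n (α := α) A => .mk (.lam α β n) fun _ => A.tree

theorem PrimConst.tree_injective {α β : Ty} (c : PrimConst C α) (d : PrimConst C β)
    (h : c.tree = d.tree) : (⟨α, .const c⟩ : Lang C) = ⟨β, .const d⟩ := by
  cases c <;> cases d <;> cases (WType.mk.inj h).1 <;> rfl

/-- The symbols record the types of the immediate parts, so a tree also determines the type of its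
wff. The two types are left independent so that the induction can compare parts whose types are not
yet known to agree. -/
theorem Wff.tree_injective {α : Ty} (A : Wff C α) :
    ∀ {β : Ty} (B : Wff C β), A.tree = B.tree → (⟨α, A⟩ : Lang C) = ⟨β, B⟩ := by
  induction A with
  | var α n =>
    intro β B h
    cases B with
    | const d => cases d <;> cases (WType.mk.inj h).1
    | _ => cases (WType.mk.inj h).1 <;> rfl
  | const c =>
    intro β B h
    cases B with
    | const d => exact c.tree_injective d h
    | _ => cases c <;> cases (WType.mk.inj h).1
  | @app α α' F A ihF ihA =>
    intro β B h
    cases B with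
    | @app _ β' G B =>
      obtain ⟨h1, h2⟩ := WType.mk.inj h
      cases h1
      have h2 := congrFun (eq_of_heq h2)
      cases ihF G (h2 true)
      cases ihA B (h2 false)
      rfl
    | const d => cases d <;> cases (WType.mk.inj h).1
    | _ => cases (WType.mk.inj h).1
  | @lam α' n α A ih =>
    intro β B h
    cases B with
    | @lam β' m β B =>
      obtain ⟨h1, h2⟩ := WType.mk.inj h
      cases h1
      cases ih B (congrFun (eq_of_heq h2) ())
      rfl
    | const d => cases d <;> cases (WType.mk.inj h).1
    | _ => cases (WType.mk.inj h).1

theorem mk_sym_le : #(Sym C) ≤ max ℵ₀ #(Σ α, C α) := by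
  let g : Sym C → (ULift.{u} (ℕ × Ty × Ty × ℕ)) ⊕ (Σ α, C α)
    | .var α n => .inl ⟨0, α, α, n⟩
    | .Q α => .inl ⟨1, α, α, 0⟩
    | .iota α => .inl ⟨2, α, α, 0⟩
    | .nonlog c => .inr c
    | .app α β => .inl ⟨3, α, β, 0⟩
    | .lam α β n => .inl ⟨4, α, β, n⟩
  have hg : Function.Injective g := by
    intro a b h
    cases a <;> cases b <;> simp_all [g]
  refine (mk_le_of_injective hg).trans ?_
  rw [mk_sum, lift_id, lift_id]
  exact (add_le_add_left mk_le_aleph0 _).trans (by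
    rw [add_eq_max le_rfl])

/-- Wffs are finitely branching trees over the symbols, which bounds their number above; variables
and constants give the lower bound. -/
theorem mk_lang (C : Ty → Type u) : #(Lang C) = max ℵ₀ #(Σ α, C α) := by
  apply le_antisymm
  · refine (mk_le_of_injective (f := fun A : Lang C => A.2.tree) fun A B h =>
      Wff.tree_injective A.2 B.2 h).trans ?_
    refine WType.cardinalMk_le_max_aleph0_of_finite'.trans ?_
    exact max_le ((lift_id'.{0, u} _).le.trans mk_sym_le) (le_max_left _ _)
  · refine max_le ?_ ?_
    · have : Infinite (Lang C) := Infinite.of_injective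
        (fun n : ℕ => (⟨o, Wff.var o n⟩ : Lang C)) fun a b h => by cases h; rfl
      exact aleph0_le_mk _
    · exact mk_le_of_injective (f := fun c : Σ α, C α => (⟨c.1, .const (.nonlog c.2)⟩ : Lang C))
        fun a b h => by
          obtain ⟨α, a⟩ := a
          obtain ⟨β, b⟩ := b
          cases h; rfl

/-- There are `ℵ₀ · ℵ₀ · #(Lang C)` new constants at most, and `Lang C` is infinite. -/
theorem mk_lang_expand (C : Ty → Type u) :
    #(Lang (Expand C fun _ => ℕ × Lang C)) = #(Lang C) := by
  have hinf : ℵ₀ ≤ #(Lang C) := (mk_lang C).symm ▸ le_max_left _ _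
  have hC : #(Σ α, C α) ≤ #(Lang C) := (mk_lang C).symm ▸ le_max_right _ _
  have hN : #(Σ _ : Ty, ℕ × Lang C) ≤ #(Lang C) := by
    have hTy : lift.{u} #Ty ≤ #(Lang C) := (lift_le_aleph0.2 mk_le_aleph0).trans hinf
    have hℕ : lift.{u} #ℕ ≤ #(Lang C) := (lift_le_aleph0.2 mk_le_aleph0).trans hinf
    rw [mk_congr (Equiv.sigmaEquivProd Ty (ℕ × Lang C)), mk_prod, mk_prod, lift_id'.{0, u},
      lift_id'.{0, u}]
    exact mul_le_of_le hinf hTy (mul_le_of_le hinf hℕ le_rfl)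
  apply le_antisymm
  · rw [mk_lang]
    refine max_le hinf ?_
    have e : (Σ α, Expand C (fun _ => ℕ × Lang C) α) ≃
        (Σ α, C α) ⊕ (Σ _ : Ty, ℕ × Lang C) := Equiv.sigmaSumDistrib _ _
    rw [mk_congr e, mk_sum, lift_id, lift_id]
    exact add_le_of_le hinf hC hN
  · rw [mk_lang, mk_lang]
    exact max_le_max le_rfl (mk_le_of_injective
      (f := fun c : Σ α, C α => (⟨c.1, Sum.inl c.2⟩ : Σ α, Expand C (fun _ => ℕ × Lang C) α))
      fun a b h => by
        obtain ⟨α, a⟩ := a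
        obtain ⟨β, b⟩ := b
        cases h; rfl)

end Q0u

namespace Q0u

open Ty

namespace Wff

open PForm

/-! ### Complete extensions -/

section Lindenbaum

variable {C : Ty → Type u} {H : Set (Wff C o)}

theorem proves_not_fls [Fact (AreSentences H)] : Proves H (not fls) :=
  (rw_not_ofBool false).symm.mp proves_tru

theorem exists_complete (hH : AreSentences H) (hc : Consistent H) :
    ∃ M, H ⊆ M ∧ AreSentences M ∧ Consistent M ∧ Complete M := by
  obtain ⟨M, hHM, hM⟩ := zorn_subset_nonempty {S : Set (Wff C o) | AreSentences S ∧ Consistent S}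
    (fun c hcS hchain hne => by
      have hU : AreSentences (⋃₀ c) := fun A ⟨S, hS, hA⟩ => (hcS hS).1 A hA
      refine ⟨⋃₀ c, ⟨hU, fun h => ?_⟩, fun S hS => Set.subset_sUnion_of_mem hS⟩
      -- A proof of `F` from the union uses finitely many hypotheses, all of which lie in one member
      -- of the chain.
      obtain ⟨T, hT, hTf, h⟩ := h.exists_finite hU
      obtain ⟨S, hS, hTS⟩ := hchain.directedOn.exists_mem_subset_of_finite_of_subset_sUnion
        hne hTf hT
      have : Fact (AreSentences S) := ⟨(hcS hS).1⟩
      exact (hcS hS).2 (h.mono hTS)) H ⟨hH, hc⟩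
  have hMs : Fact (AreSentences M) := ⟨hM.prop.1⟩
  refine ⟨M, hHM, hM.prop.1, hM.prop.2, fun A hA => ?_⟩
  by_cases h : Consistent (insert A M)
  · exact Or.inl (.hyp (hM.le_of_ge ⟨hM.prop.1.insert hA, h⟩ (Set.subset_insert A M)
      (Set.mem_insert A M)))
  · right
    -- If `A` cannot be added consistently, the deduction theorem gives `A ⊃ F`, hence `∼A`.
    have h1 := (not_not.1 h).deduction hA
    exact proves_not_fls.R2 (h1.R2 (taut (.imp (.imp (.atom 0) (.atom 1)) (.imp (.not (.atom 1))
      (.not (.atom 0)))) ![A, fls] (by decide)))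

end Lindenbaum

/-! ### Witnesses -/

variable {C : Ty → Type u}

/-- The nonlogical constants of the language with witnesses. The first component of a new constant
is its level. -/
abbrev WithWitnesses (C : Ty → Type u) : Ty → Type u := Expand C fun _ => ℕ × Lang C

/-- The level of a constant of the language with witnesses. -/
def constLevel : {α : Ty} → PrimConst (WithWitnesses C) α → ℕ
  | _, .nonlog (.inr c) => c.1 + 1
  | _, _ => 0

/-- The least number exceeding the levels of all the witnesses in a wff. -/
def level : {α : Ty} → Wff (WithWitnesses C) α → ℕ
  | _, var _ _ => 0
  | _, const c => constLevel c
  | _, app F A => max F.level A.level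
  | _, lam _ _ A => A.level

/-- A numbering of the wffs with witnesses by wffs without. -/
noncomputable def langCode (C : Ty → Type u) : Lang (WithWitnesses C) ≃ Lang C :=
  Classical.choice (Cardinal.eq.1 (mk_lang_expand C))

/-- Pairs of closed wffs of the same functional type. -/
structure ClosedPair (C : Ty → Type u) where
  (α β : Ty)
  (A B : Wff (WithWitnesses C) (fn α β))
  (closed_left : A.Closed)
  (closed_right : B.Closed)

namespace ClosedPair

variable (p q : ClosedPair C)

/-- The level of the witness for a pair. -/
def level : ℕ := max p.A.level p.B.level

/-- The new constant that is the witness for a pair. -/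
noncomputable def newConst : WithWitnesses C p.β := .inr (p.level, langCode C ⟨o, eq p.A p.B⟩)

/-- The witness for a pair, as a wff. -/
noncomputable def wit : Wff (WithWitnesses C) p.β := const (.nonlog p.newConst)

/-- The sentence saying that two functions that agree at the witness are equal. -/
noncomputable def ax : Wff (WithWitnesses C) o :=
  imp (and (and (dfd p.A) (dfd p.B)) (qe (app p.A p.wit) (app p.B p.wit))) (eq p.A p.B)

theorem closed_ax : p.ax.Closed := fun β n => by
  have h1 := p.closed_left β n
  have h2 := p.closed_right β n
  simp [ax, dfd, qe, h1, h2, wit]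

variable {p q} in
theorem eq_of_newConst (h : (⟨p.β, p.newConst⟩ : Σ β, WithWitnesses C β) = ⟨q.β, q.newConst⟩) :
    p = q := by
  have key : langCode C ⟨o, Wff.eq p.A p.B⟩ = langCode C ⟨o, Wff.eq q.A q.B⟩ := by
    have := congrArg (fun c : Σ β, WithWitnesses C β => Sum.elim (fun _ => none)
      (fun d : ℕ × Lang C => some d.2) c.2) h
    exact Option.some.inj this
  have := (langCode C).injective key
  obtain ⟨α, β, A, B, _, _⟩ := p
  obtain ⟨α', β', A', B', _, _⟩ := q
  cases this
  rfl

end ClosedPair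

/-! ### Generalizing on a witness, and consistency -/

open Classical in
/-- The assignment replacing a nonlogical constant `c` by the variable with number `m`. -/
noncomputable def generalize (c : Σ α, C α) (m : ℕ) (α : Ty) (d : C α) : Wff C α :=
  if (⟨α, d⟩ : Σ α, C α) = c then var α m else const (.nonlog d)

theorem constOrVar_generalize (c : Σ α, C α) (m : ℕ) : ConstOrVar (generalize c m) m := by
  intro α d
  by_cases h : (⟨α, d⟩ : Σ α, C α) = c
  · exact Or.inr ⟨m, le_rfl, if_pos h⟩
  · exact Or.inl ⟨_, if_neg h⟩

/-- The witness for `p` has level `p.level + 1`, so it cannot occur in a wff of level at most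
`p.level`. -/
theorem tr_generalize_of_level (p : ClosedPair C) (m : ℕ) :
    ∀ {α : Ty} {A : Wff (WithWitnesses C) α}, A.level ≤ p.level →
      A.tr (generalize ⟨p.β, p.newConst⟩ m) = A
  | _, var _ _, _ => rfl
  | _, const (.Q _), _ => rfl
  | _, const (.iota _ _), _ => rfl
  | _, const (.nonlog (.inl c)), _ => by
      refine if_neg fun h => ?_
      have := congrArg (fun c : Σ β, WithWitnesses C β => c.2.isLeft) h
      exact Bool.noConfusion this
  | _, const (.nonlog (.inr c)), hA => by
      refine if_neg fun h => ?_
      have := congrArg (fun c : Σ β, WithWitnesses C β => Sum.elim (fun _ => 0)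
        (fun d : ℕ × Lang C => d.1) c.2) h
      have : c.1 = p.level := this
      have : c.1 + 1 ≤ p.level := hA
      omega
  | _, app F A, hA => by
      have h := max_le_iff.1 hA
      rw [tr, tr_generalize_of_level p m h.1, tr_generalize_of_level p m h.2]
  | _, lam _ _ A, hA => by rw [tr, tr_generalize_of_level p m (A := A) hA]

theorem level_expand {α : Ty} (A : Wff C α) : (A.expand fun _ => ℕ × Lang C).level = 0 := by
  induction A with
  | var => rfl
  | const c => cases c <;> rfl
  | app F A ihF ihA => simp [expand, level, ihF, ihA]
  | lam β n A ih => simpa [expand, level] using ih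

theorem free_expand {N : Ty → Type u} {β : Ty} {n : ℕ} {α : Ty} (A : Wff C α) :
    (A.expand N).Free β n ↔ A.Free β n := by
  induction A with
  | var => rfl
  | const c => rfl
  | app F A ihF ihA => simp [expand, ihF, ihA]
  | lam β n A ih => simp [expand, ih]

theorem AreSentences.expand {H : Set (Wff C o)} (hH : AreSentences H) (N : Ty → Type u) :
    AreSentences (Wff.expand N '' H) := by
  rintro _ ⟨A, hA, rfl⟩ β n
  rw [free_expand]
  exact hH A hA β n

/-- Adding constants preserves consistency. -/
theorem Consistent.expand {H : Set (Wff C o)} (hH : AreSentences H) (hc : Consistent H)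
    (N : Ty → Type u) : Consistent (Wff.expand N '' H) := fun h => by
  have : Fact (AreSentences H) := ⟨hH⟩
  obtain ⟨m, h⟩ := h.tr (H' := H)
  -- All new constants of a type may be sent to the same variable, since the hypotheses contain none
  -- of them.
  let f : ∀ α, Expand C N α → Wff C α := fun α c =>
    Sum.elim (fun d => const (.nonlog d)) (fun _ => var α m) c
  have hf : ∀ {α : Ty} (A : Wff C α), (A.expand N).tr f = A := by
    intro α A
    induction A with
    | var => rfl
    | const c => cases c <;> rfl
    | app F A ihF ihA => simp [Wff.expand, tr, ihF, ihA]
    | lam β n A ih => simp [Wff.expand, tr, ih]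
  refine hc (h f ?_ ?_)
  · rintro α (c | c)
    · exact Or.inl ⟨_, rfl⟩
    · exact Or.inr ⟨m, le_rfl, rfl⟩
  · rintro _ ⟨A, hA, rfl⟩
    rw [hf]
    exact .hyp hA

/-- The witness for `p` is too high to occur in the two wffs of `q`, and it is not the witness for
`q`, since a witness determines its pair. -/
theorem ClosedPair.tr_ax {p q : ClosedPair C} (m : ℕ) (hle : q.level ≤ p.level) (hne : q ≠ p) :
    q.ax.tr (generalize ⟨p.β, p.newConst⟩ m) = q.ax := by
  have hA := tr_generalize_of_level p m ((le_max_left q.A.level q.B.level).trans hle)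
  have hB := tr_generalize_of_level p m ((le_max_right q.A.level q.B.level).trans hle)
  have hw : q.wit.tr (generalize ⟨p.β, p.newConst⟩ m) = q.wit :=
    if_neg fun h => hne (eq_of_newConst h)
  change imp (and (and (dn q.A.bd (q.A.tr _)) (dn q.B.bd (q.B.tr _)))
    (qn (app q.A q.wit).bd (app q.B q.wit).bd (app (q.A.tr _) (q.wit.tr _))
      (app (q.B.tr _) (q.wit.tr _)))) (eq (q.A.tr _) (q.B.tr _)) = _
  rw [hA, hB, hw]
  rfl

/-- The axiom on a witness that does not occur in the hypotheses can be added consistently. -/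
theorem Consistent.insert_ax {K : Set (Wff (WithWitnesses C) o)} (hK : AreSentences K)
    (hc : Consistent K) (p : ClosedPair C)
    (htr : ∀ m, ∀ A ∈ K, A.tr (generalize ⟨p.β, p.newConst⟩ m) = A) :
    Consistent (insert p.ax K) := fun h => by
  have : Fact (AreSentences K) := ⟨hK⟩
  have h1 := h.deduction p.closed_ax
  -- Refuting the axiom means proving its antecedent together with the negation of its consequent.
  have h2 : Proves K (and (and (and (dfd p.A) (dfd p.B))
      (qe (app p.A p.wit) (app p.B p.wit))) (not (eq p.A p.B))) :=
    proves_not_fls.R2 (h1.R2 (taut (.imp (.imp (.imp (.and (.and (.atom 0) (.atom 1)) (.atom 2))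
      (.atom 3)) (.atom 4)) (.imp (.not (.atom 4)) (.and (.and (.and (.atom 0) (.atom 1))
      (.atom 2)) (.not (.atom 3))))) ![_, _, _, _, fls] (by decide)))
  have hA : Df K p.A := df_iff.2 (h2.R2 (taut (.imp (.and (.and (.and (.atom 0) (.atom 1))
    (.atom 2)) (.atom 3)) (.atom 0)) ![_, _, _, _] (by decide)))
  have hB : Df K p.B := df_iff.2 (h2.R2 (taut (.imp (.and (.and (.and (.atom 0) (.atom 1))
    (.atom 2)) (.atom 3)) (.atom 1)) ![_, _, _, _] (by decide)))
  have hq : Proves K (qe (app p.A p.wit) (app p.B p.wit)) :=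
    h2.R2 (taut (.imp (.and (.and (.and (.atom 0) (.atom 1))
      (.atom 2)) (.atom 3)) (.atom 2)) ![_, _, _, _] (by decide))
  have hn : Proves K (not (eq p.A p.B)) :=
    h2.R2 (taut (.imp (.and (.and (.and (.atom 0) (.atom 1))
      (.atom 2)) (.atom 3)) (.atom 3)) ![_, _, _, _] (by decide))
  obtain ⟨N, hN⟩ := hq.tr (H' := K)
  -- `m` has to be new to the proof of `hq`, and also to differ from the bound variables `p.A.bd`
  -- and `p.B.bd` in the quasi-equation.
  obtain ⟨m, hm⟩ : ∃ m, m = max N (max p.A.bd p.B.bd + 1) := ⟨_, rfl⟩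
  have h3 := hN _ ((constOrVar_generalize ⟨p.β, p.newConst⟩ m).mono (by omega))
    fun A hA => by rw [htr m A hA]; exact .hyp hA
  have h4 : Proves K (qn p.A.bd p.B.bd (app p.A (var p.β m)) (app p.B (var p.β m))) := by
    have hA' := tr_generalize_of_level p m (le_max_left p.A.level p.B.level)
    have hB' := tr_generalize_of_level p m (le_max_right p.A.level p.B.level)
    have hw : p.wit.tr (generalize ⟨p.β, p.newConst⟩ m) = var p.β m := if_pos rfl
    have eA : (app p.A p.wit).bd = p.A.bd := by simp [bd, ClosedPair.wit]
    have eB : (app p.B p.wit).bd = p.B.bd := by simp [bd, ClosedPair.wit]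
    change Proves K (qn (app p.A p.wit).bd (app p.B p.wit).bd (app (p.A.tr _) (p.wit.tr _))
      (app (p.B.tr _) (p.wit.tr _))) at h3
    rwa [hA', hB', hw, eA, eB] at h3
  have hocc {F : Wff (WithWitnesses C) (fn p.α p.β)} (hF : F.bd < m) :
      ¬ (app F (var p.β m)).Occurs p.α F.bd := by
    rintro (h | h)
    · exact not_occurs_of_bd_le le_rfl h
    · exact absurd h.2 hF.ne'
  -- The bound variables are renamed to meet the requirements of `rw_ext`: one common number,
  -- greater than `3` and than `m`.
  have h5 : Proves K (qn (m + 4) (m + 4) (app p.A (var p.β m)) (app p.B (var p.β m))) :=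
    ((rw_qe ⟨_, hocc (by omega)⟩ ⟨_, hocc (by omega)⟩).trans
      (rw_qn_qe (by simp [bd]; omega) (by simp [bd]; omega)).symm).mp h4
  have h6 : Proves K (eq p.A p.B) := (rw_ext hA hB (p.closed_left _ _) (p.closed_right _ _)
    (by omega) (by omega) (p.closed_left _ _) (p.closed_right _ _)).symm.mp (h5.gen p.β m)
  exact hc (h6.R2 (hn.R2 (taut (.imp (.not (.atom 0)) (.imp (.atom 0) (.atom 1)))
    ![_, fls] (by decide))))

theorem consistent_witnesses {G : Set (Wff C o)} (hG : AreSentences G) (hc : Consistent G) :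
    Consistent (expand (fun _ => ℕ × Lang C) '' G ∪ Set.range (ClosedPair.ax (C := C))) := by
  classical
  set G' := expand (fun _ => ℕ × Lang C) '' G
  have hG' : AreSentences G' := hG.expand _
  have hs (s : Set (ClosedPair C)) : AreSentences (G' ∪ ClosedPair.ax '' s) := by
    rintro A (hA | ⟨p, -, rfl⟩)
    · exact hG' A hA
    · exact p.closed_ax
  have key (s : Finset (ClosedPair C)) : Consistent (G' ∪ ClosedPair.ax '' (s : Set _)) := by
    -- Adding the axioms by increasing level ensures that each new witness is absent from everything
    -- added before.
    refine Finset.induction_on_max_value ClosedPair.level s ?_ ?_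
    · simpa using hc.expand hG _
    · intro p s hp hmax ih
      rw [Finset.coe_insert, Set.image_insert_eq, Set.union_insert]
      refine ih.insert_ax (hs _) p ?_
      rintro m A (⟨B, -, rfl⟩ | ⟨q, hq, rfl⟩)
      · exact tr_generalize_of_level p m ((level_expand B).le.trans (Nat.zero_le _))
      · exact ClosedPair.tr_ax m (hmax q hq) fun h => hp (h ▸ hq)
  intro h
  rw [← Set.image_univ] at h
  obtain ⟨T, hT, hTf, h⟩ := h.exists_finite (hs _)
  -- Finitely many pairs account for the hypotheses of the proof that do not come from `G'`.
  obtain ⟨s, -, hsf, hs'⟩ := (hTf.sdiff (t := G')).exists_subset_finite_image_eq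
    (f := ClosedPair.ax) (s := Set.univ) fun A hA => (hT hA.1).resolve_left hA.2
  have : Fact (AreSentences (G' ∪ ClosedPair.ax '' (hsf.toFinset : Set (ClosedPair C)))) := ⟨hs _⟩
  refine key hsf.toFinset (h.mono fun A hA => ?_)
  rw [hsf.coe_toFinset, hs']
  by_cases hAG : A ∈ G'
  · exact Or.inl hAG
  · exact Or.inr ⟨hA, hAG⟩

/-- Each axiom fixes one choice of bound variables in the abbreviations; the other choices follow by
rewriting. -/
theorem extensionallyComplete_of_witnesses {H : Set (Wff (WithWitnesses C) o)}
    (hH : AreSentences H) (hw : Set.range (ClosedPair.ax (C := C)) ⊆ H) :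
    ExtensionallyComplete H := by
  intro α β A B hAB
  have : Fact (AreSentences H) := ⟨hH⟩
  let p : ClosedPair C := ⟨α, β, A, B, fun γ n h => hAB γ n ((free_eq A B).2 (Or.inl h)),
    fun γ n h => hAB γ n ((free_eq A B).2 (Or.inr h))⟩
  refine ⟨p.wit, fun _ _ => id, fun k => (Schema.A6 _ k).proves, fun i j k l => ?_⟩
  have h : Proves H p.ax := .hyp (hw ⟨p, rfl⟩)
  exact ((((rw_dfd i).and (rw_dfd j)).and (rw_qe k l)).imp (Rw.refl _)).symm.mp h

end Wff

end Q0u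

/-! ### The extension lemma -/

theorem mainTheorem4 (C : Q0u.Ty → Type u) (G : Set (Q0u.Wff C Q0u.Ty.o))
    (hG : Q0u.Wff.AreSentences G) (hcons : Q0u.Wff.Consistent G) :
    ∃ (N : Q0u.Ty → Type u) (H : Set (Q0u.Wff (Q0u.Expand C N) Q0u.Ty.o)),
      Q0u.Wff.AreSentences H ∧
      Q0u.Wff.expand N '' G ⊆ H ∧
      Q0u.Wff.Consistent H ∧
      Q0u.Wff.Complete H ∧
      Q0u.Wff.ExtensionallyComplete H ∧
      Cardinal.mk (Q0u.Lang (Q0u.Expand C N)) = Cardinal.mk (Q0u.Lang C) := by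
  have hs : Q0u.Wff.AreSentences (Q0u.Wff.expand (fun _ => ℕ × Q0u.Lang C) '' G ∪
      Set.range (Q0u.Wff.ClosedPair.ax (C := C))) := by
    rintro A (hA | ⟨p, rfl⟩)
    · exact hG.expand _ A hA
    · exact p.closed_ax
  obtain ⟨M, hM, hMs, hMc, hMcomp⟩ :=
    Q0u.Wff.exists_complete hs (Q0u.Wff.consistent_witnesses hG hcons)
  exact ⟨_, M, hMs, Set.subset_union_left.trans hM, hMc, hMcomp,
    Q0u.Wff.extensionallyComplete_of_witnesses hMs (Set.subset_union_right.trans hM),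
    Q0u.mk_lang_expand C⟩
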